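/- **Setting.** Let $H_{2n+1}$ be the group of real $(n+2)\times(n+2)$ matrices $\begin{pmatrix}1&v^T&x\\0&\mathrm{Id}_n&w\\0&0&1\end{pmatrix}$ with $v,w\in\mathbb R^n$, $x\in\mathbb R$, a Lie group with global chart $(v,w,x)$, and let $\hat E_p,\hat F_p,\hat Z$ ($1\le p\le n$) be the basis of its Lie algebra $\mathfrak h_{2n+1}$ given by the coordinate vectors $\partial_{v_p},\partial_{w_p},\partial_x$ at the identity. Let $a,b\in\mathbb R_{>0}^n$, $c>0$. The vectors $Z=\hat Z/\sqrt c$, $E_p=\hat E_p/\sqrt{a_p}$, $F_p=\hat F_p/\sqrt{b_p}$ satisfy $$[E_p,F_q]=\delta_{pq}\sqrt{\tfrac{c}{a_pb_p}}\;Z,\qquad [E_p,Z]=[F_p,Z]=[E_p,E_q]=[F_p,F_q]=0,\tag{$*$}$$ and they are orthonormal for some left-invariant Riemannian metric on $H_{2n+1}$. More generally, let $g$ be a left-invariant Riemannian metric on $H_{2n+1}$ and $(Z,E_1,F_1,\dots,E_n,F_n)$ a $g$-orthonormal basis of $\mathfrak h_{2n+1}$ satisfying $(*)$. Let $\Sigma=\Lambda^\bullet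 L'$, where $L'$ is the complex vector space with basis $y_p=\frac1{\sqrt2}(E_p+iF_p)$, and let $x_p\lrcorner$ be the antiderivation of $\Sigma$ with $x_p\lrcorner y_q=\delta_{pq}$. The Clifford action of the basis on $\Sigma$ is $$Z\cdot\eta=i(\eta_{\rm even}-\eta_{\rm odd}),\quad E_p\cdot\eta=i(x_p\lrcorner\eta+y_p\wedge\eta),\quad F_p\cdot\eta=y_p\wedge\eta-x_p\lrcorner\eta .$$ Trivialise the spinor bundle of the invariant spin structure as $H_{2n+1}\times\Sigma$ by the left-invariant frame $(e_i)$ extending the basis, so that spinor fields are smooth maps $\psi:H_{2n+1}\to\Sigma$, invariant ones are the constant maps, and the spin connection is $\widetilde\nabla_X\psi=d\psi(X)+\frac12\sum_{i<j}g(\nabla_Xe_i,e_j)\,e_i\cdot e_j\cdot\psi$, with $\nabla$ the Levi-Civita connection of $g$. A spinor field $\psi$ is *generalised Killing* if there is a smooth $g$-symmetric endomorphism field $A$ of the tangent bundle with $\widetilde\nabla_X\psi=A(X)\cdot\psi$ for all $X$; the eigenvalues of $A$ are called the eigenvalues of $\psi$. **Theorem.** For all $n$, $a$, $b$, $c$,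 $g$ and bases as above, the Levi-Civita connection exists and the invariant spinor determined by $1\in\Sigma$ is a generalised Killing spinor. For every such $A$, the set of eigenvalues of $A$ at each point is $$\Big\{\lambda_p=\tfrac14\sqrt{\tfrac{c}{a_pb_p}}\;:\;1\le p\le n\Big\}\cup\Big\{\mu=-\sum_{q=1}^n\lambda_q\Big\}.$$ In particular, when $b_p=c=1$, $a_p=p^2$ and $g$ is a left-invariant metric for which $\hat Z/\sqrt c$, $\hat E_p/\sqrt{a_p}$, $\hat F_p/\sqrt{b_p}$ are orthonormal, there are exactly $n+1$ distinct eigenvalues. Hence for every $r\ge1$ there are an $n$ and a left-invariant metric on $H_{2n+1}$ carrying a non-zero invariant generalised Killing spinor with exactly $r$ distinct eigenvalues. -/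

import Mathlib

open scoped Manifold ContDiff

noncomputable section

/-! ## The Heisenberg group -/

/-- The model vector space `ℝⁿ × ℝⁿ × ℝ` of the Heisenberg group. -/
abbrev HeisModel (n : ℕ) : Type := (Fin n → ℝ) × (Fin n → ℝ) × ℝ

/-- The Heisenberg group `H_{2n+1}`: the element `(v, w, x)` stands for the matrix
`Heisenberg.toMatrix (v, w, x)`, with rows `(1, vᵀ, x)`, `(0, Id, w)`, `(0, 0, 1)`. The topology and
the smooth structure are those of the global chart `(v, w, x)`. -/
def Heisenberg (n : ℕ) : Type := HeisModel n

namespace Heisenberg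

variable {n : ℕ}

instance : TopologicalSpace (Heisenberg n) := inferInstanceAs (TopologicalSpace (HeisModel n))

instance : ChartedSpace (HeisModel n) (Heisenberg n) :=
  inferInstanceAs (ChartedSpace (HeisModel n) (HeisModel n))

instance (k : WithTop ℕ∞) : IsManifold 𝓘(ℝ, HeisModel n) k (Heisenberg n) :=
  inferInstanceAs (IsManifold 𝓘(ℝ, HeisModel n) k (HeisModel n))

/-- The point with coordinates `(v, w, x)`. -/
def mk (v w : Fin n → ℝ) (x : ℝ) : Heisenberg n := (v, w, x)

/-- The entry `v`. -/
def v (g : Heisenberg n) : Fin n → ℝ := g.1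
/-- The entry `w`. -/
def w (g : Heisenberg n) : Fin n → ℝ := g.2.1
/-- The entry `x`. -/
def x (g : Heisenberg n) : ℝ := g.2.2

@[ext] theorem ext {g h : Heisenberg n} (hv : g.v = h.v) (hw : g.w = h.w) (hx : g.x = h.x) :
    g = h := Prod.ext hv (Prod.ext hw hx)

instance : Mul (Heisenberg n) := ⟨fun g h => mk (g.v + h.v) (g.w + h.w) (g.x + h.x + g.v ⬝ᵥ h.w)⟩
instance : One (Heisenberg n) := ⟨mk 0 0 0⟩
instance : Inv (Heisenberg n) := ⟨fun g => mk (-g.v) (-g.w) (-g.x + g.v ⬝ᵥ g.w)⟩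

@[simp] theorem mul_v (g h : Heisenberg n) : (g * h).v = g.v + h.v := rfl
@[simp] theorem mul_w (g h : Heisenberg n) : (g * h).w = g.w + h.w := rfl
@[simp] theorem mul_x (g h : Heisenberg n) : (g * h).x = g.x + h.x + g.v ⬝ᵥ h.w := rfl
@[simp] theorem one_v : (1 : Heisenberg n).v = 0 := rfl
@[simp] theorem one_w : (1 : Heisenberg n).w = 0 := rfl
@[simp] theorem one_x : (1 : Heisenberg n).x = 0 := rfl
@[simp] theorem inv_v (g : Heisenberg n) : (g⁻¹).v = -g.v := rfl
@[simp] theorem inv_w (g : Heisenberg n) : (g⁻¹).w = -g.w := rfl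
@[simp] theorem inv_x (g : Heisenberg n) : (g⁻¹).x = -g.x + g.v ⬝ᵥ g.w := rfl

instance : Group (Heisenberg n) :=
  Group.ofLeftAxioms
    (fun a b c => by
      ext1
      · simp [add_assoc]
      · simp [add_assoc]
      · simp only [mul_x, mul_v, mul_w, add_dotProduct, dotProduct_add]; ring)
    (fun a => by ext1 <;> simp)
    (fun a => by ext1 <;> simp)

/-- The `(n+2) × (n+2)` matrix with rows `(1, vᵀ, x)`, `(0, Id, w)`, `(0, 0, 1)`. -/
def toMatrix (g : Heisenberg n) : Matrix (Unit ⊕ Fin n ⊕ Unit) (Unit ⊕ Fin n ⊕ Unit) ℝ :=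
  Matrix.fromBlocks 1
    (Matrix.fromCols (Matrix.of fun _ j => g.v j) (Matrix.of fun _ _ => g.x)) 0
    (Matrix.fromBlocks 1 (Matrix.of fun i _ => g.w i) 0 1)

/-- The group law is matrix multiplication. -/
theorem toMatrix_mul (g h : Heisenberg n) : (g * h).toMatrix = g.toMatrix * h.toMatrix := by
  ext i j
  rcases i with i | i | i <;> rcases j with j | j | j <;>
    simp [toMatrix, Matrix.mul_apply, Matrix.one_apply, dotProduct, add_comm, add_left_comm,
      add_assoc]

theorem toMatrix_injective : Function.Injective (toMatrix (n := n)) := by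
  intro g h H
  ext i
  · simpa [toMatrix] using congrFun (congrFun H (Sum.inl ())) (Sum.inr (Sum.inl i))
  · simpa [toMatrix] using congrFun (congrFun H (Sum.inr (Sum.inl i))) (Sum.inr (Sum.inr ()))
  · simpa [toMatrix] using congrFun (congrFun H (Sum.inl ())) (Sum.inr (Sum.inr ()))

instance : LieGroup 𝓘(ℝ, HeisModel n) ∞ (Heisenberg n) where
  contMDiff_mul := by
    have h : ContDiff ℝ ∞ (fun p : HeisModel n × HeisModel n =>
        ((p.1.1 + p.2.1, p.1.2.1 + p.2.2.1,
          p.1.2.2 + p.2.2.2 + ∑ i, p.1.1 i * p.2.2.1 i) : HeisModel n)) := by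
      fun_prop
    have h' := h.contMDiff
    rw [modelWithCornersSelf_prod, ← chartedSpaceSelf_prod] at h'
    exact h'
  contMDiff_inv := by
    have h : ContDiff ℝ ∞ (fun p : HeisModel n =>
        ((-p.1, -p.2.1, -p.2.2 + ∑ i, p.1 i * p.2.1 i) : HeisModel n)) := by
      fun_prop
    exact h.contMDiff

end Heisenberg

/-- The Lie algebra `𝔥_{2n+1}` of `H_{2n+1}`: the tangent space at the identity, with the bracket of
left-invariant vector fields. -/
abbrev HeisAlg (n : ℕ) : Type := GroupLieAlgebra 𝓘(ℝ, HeisModel n) (Heisenberg n)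

/-- Indices of a basis `(Z, E_1, F_1, …, E_n, F_n)`. -/
abbrev HeisIndex (n : ℕ) : Type := Unit ⊕ (Fin n ⊕ Fin n)

namespace HeisIndex

variable {n : ℕ}

/-- The index of `Z`. -/
abbrev Z : HeisIndex n := Sum.inl ()
/-- The index of `E_p`. -/
abbrev E (p : Fin n) : HeisIndex n := Sum.inr (Sum.inl p)
/-- The index of `F_p`. -/
abbrev F (p : Fin n) : HeisIndex n := Sum.inr (Sum.inr p)

end HeisIndex

/-- The rescaled standard basis `Ẑ / √c`, `Ê_p / √a_p`, `F̂_p / √b_p` of `𝔥_{2n+1}`, where `Ẑ`, `Ê_p`,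
`F̂_p` are the tangent vectors at the identity of the coordinates `x`, `v_p`, `w_p`. -/
def heisBasis {n : ℕ} (a b : Fin n → ℝ) (c : ℝ) : HeisIndex n → HeisAlg n
  | Sum.inl _ => ((0, 0, (√c)⁻¹) : HeisModel n)
  | Sum.inr (Sum.inl p) => ((Pi.single p (√(a p))⁻¹, 0, 0) : HeisModel n)
  | Sum.inr (Sum.inr p) => ((0, Pi.single p (√(b p))⁻¹, 0) : HeisModel n)

/-- The Lie bracket relations of `Z = Ẑ / √c`, `E_p = Ê_p / √a_p`, `F_p = F̂_p / √b_p`. -/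
structure HasHeisRelations {n : ℕ} (a b : Fin n → ℝ) (c : ℝ) (u : HeisIndex n → HeisAlg n) :
    Prop where
  lie_E_F : ∀ p q, ⁅u (.E p), u (.F q)⁆ = if p = q then √(c / (a p * b p)) • u .Z else 0
  lie_E_Z : ∀ p, ⁅u (.E p), u .Z⁆ = 0
  lie_F_Z : ∀ p, ⁅u (.F p), u .Z⁆ = 0
  lie_E_E : ∀ p q, ⁅u (.E p), u (.E q)⁆ = 0
  lie_F_F : ∀ p q, ⁅u (.F p), u (.F q)⁆ = 0

/-! ## Riemannian metrics and spinors on manifolds with a global orthonormal frame -/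

section General

variable {V : Type*} [NormedAddCommGroup V] [NormedSpace ℝ V] {H : Type*} [TopologicalSpace H]
  {I : ModelWithCorners ℝ V H} {M : Type*} [TopologicalSpace M] [ChartedSpace H M]
  [IsManifold I ∞ M]

variable (I M) in
/-- Smooth Riemannian metrics on `M`. -/
abbrev RiemMetric : Type _ :=
  Bundle.ContMDiffRiemannianMetric I ∞ V (fun x : M => TangentSpace I x)

/-- The metric `g` on the Lie group `M` is left-invariant. -/
def IsLeftInvariant [Group M] (g : RiemMetric I M) : Prop :=
  ∀ (x y : M) (v w : TangentSpace I y),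
    g.inner (x * y) (mfderiv I I (x * ·) y v) (mfderiv I I (x * ·) y w) = g.inner y v w

/-- `∇` is the Levi-Civita connection of `g`: it is torsion-free, and it is metric, that is
`X (g(σ, τ)) = g(∇_X σ, τ) + g(σ, ∇_X τ)`. -/
def IsLeviCivita [FiniteDimensional ℝ V] (g : RiemMetric I M)
    (nabla : CovariantDerivative I V (fun x : M => TangentSpace I x)) : Prop :=
  haveI : CompleteSpace V := FiniteDimensional.complete ℝ V
  nabla.torsion = 0 ∧
  ∀ (σ τ : ∀ x : M, TangentSpace I x) (x : M) (X : TangentSpace I x),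
    MDifferentiableAt I (I.prod 𝓘(ℝ, V)) (fun y => (⟨y, σ y⟩ : TangentBundle I M)) x →
    MDifferentiableAt I (I.prod 𝓘(ℝ, V)) (fun y => (⟨y, τ y⟩ : TangentBundle I M)) x →
    mvfderiv I (fun y => g.inner y (σ y) (τ y)) x X =
      g.inner x (nabla σ x X) (τ x) + g.inner x (σ x) (nabla τ x X)

variable {ι : Type*} [Fintype ι] {S : Type*} [NormedAddCommGroup S] [NormedSpace ℂ S]

/-- A global `g`-orthonormal frame `e` trivialises the orthonormal frame bundle, hence determines a
(trivial) spin structure, with spinor bundle `M × S` if the operators `γ i` are the Clifford action of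
the basis vectors `e_i` on the spin module `S`. This is Clifford multiplication of the spinor `s` at `x`
by the tangent vector `X = ∑ i, g(X, e_i) e_i`. -/
def cliffordMul (g : RiemMetric I M) (e : ι → ∀ x : M, TangentSpace I x) (γ : ι → S →ₗ[ℂ] S)
    (x : M) (X : TangentSpace I x) (s : S) : S :=
  ∑ i, (g.inner x X (e i x) : ℂ) • γ i s

/-- The lift to spinors of the skew endomorphism `A` of the span of the orthonormal `e_i`, given by its
coefficients `A i j = ⟨A e_i, e_j⟩`. It is the isomorphism `𝔰𝔬(m) ≅ 𝔰𝔭𝔦𝔫(m)`,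
`e_i ∧ e_j ↦ (1/2) e_i · e_j`, where `e_i ∧ e_j` maps `e_i` to `e_j` and `e_j` to `- e_i`: indeed `A` is
the sum of the `A i j • (e_i ∧ e_j)` over the unordered pairs, that is half the sum over all `(i, j)`. -/
def spinLift (γ : ι → S →ₗ[ℂ] S) (A : ι → ι → ℝ) (s : S) : S :=
  (1 / 2 : ℂ) • ∑ i, ∑ j, (A i j : ℂ) • ((1 / 2 : ℂ) • γ i (γ j s))

/-- The spin connection `(∇̃_X ψ)(x)` on spinor fields `ψ : M → S` in the trivialisation given by `e`:
the derivative of `ψ` plus the lift of the connection form `g(∇_X e_i, e_j)` of `∇`. -/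
def spinConnection (g : RiemMetric I M)
    (nabla : CovariantDerivative I V (fun x : M => TangentSpace I x))
    (e : ι → ∀ x : M, TangentSpace I x) (γ : ι → S →ₗ[ℂ] S) (ψ : M → S)
    (x : M) (X : TangentSpace I x) : S :=
  mvfderiv I ψ x X + spinLift γ (fun i j => g.inner x (nabla (e i) x X) (e j x)) (ψ x)

/-- The smooth spinor field `ψ` is generalised Killing with endomorphism `A`: `A` is a smooth
`g`-symmetric endomorphism field, and `∇̃_X ψ = A(X) · ψ` for all `X`. -/
structure IsGenKillingWith (g : RiemMetric I M)
    (nabla : CovariantDerivative I V (fun x : M => TangentSpace I x))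
    (e : ι → ∀ x : M, TangentSpace I x) (γ : ι → S →ₗ[ℂ] S) (ψ : M → S)
    (A : ∀ x : M, TangentSpace I x →L[ℝ] TangentSpace I x) : Prop where
  smooth_spinor : ContMDiff I 𝓘(ℝ, S) ∞ ψ
  smooth_endo : ContMDiff I (I.prod 𝓘(ℝ, V →L[ℝ] V)) ∞
    (fun x => Bundle.TotalSpace.mk' (V →L[ℝ] V)
      (E := fun x : M => TangentSpace I x →L[ℝ] TangentSpace I x) x (A x))
  symm : ∀ (x : M) (X Y : TangentSpace I x), g.inner x (A x X) Y = g.inner x X (A x Y)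
  eq : ∀ (x : M) (X : TangentSpace I x),
    spinConnection g nabla e γ ψ x X = cliffordMul g e γ x (A x X) (ψ x)

/-- The spinor field `ψ` is a generalised Killing spinor. -/
def IsGenKilling (g : RiemMetric I M)
    (nabla : CovariantDerivative I V (fun x : M => TangentSpace I x))
    (e : ι → ∀ x : M, TangentSpace I x) (γ : ι → S →ₗ[ℂ] S) (ψ : M → S) : Prop :=
  ∃ A, IsGenKillingWith g nabla e γ ψ A

/-- The set of eigenvalues at `x` of an endomorphism field. -/
def eigenvaluesAt (A : ∀ x : M, TangentSpace I x →L[ℝ] TangentSpace I x) (x : M) : Set ℝ :=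
  {r | Module.End.HasEigenvalue ((A x : TangentSpace I x →ₗ[ℝ] TangentSpace I x)) r}

end General

/-! ## The spin module -/

section Spinor

variable {n : ℕ}

instance : Module.Finite ℂ (ExteriorAlgebra ℂ (Fin n → ℂ)) := by
  classical
  have h1 : (⨆ k, ⋀[ℂ]^k (Fin n → ℂ)) = ⊤ :=
    (DirectSum.Decomposition.isInternal
      (fun k => ⋀[ℂ]^k (Fin n → ℂ))).submodule_iSup_eq_top
  have h2 : (⨆ k, ⋀[ℂ]^k (Fin n → ℂ)) ≤ ⨆ k ∈ Finset.range (n + 1), ⋀[ℂ]^k (Fin n → ℂ) := by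
    refine iSup_le fun k => ?_
    by_cases hk : k < n + 1
    · exact le_iSup₂_of_le k (Finset.mem_range.2 hk) le_rfl
    · have : Module.finrank ℂ (⋀[ℂ]^k (Fin n → ℂ)) = 0 := by
        rw [exteriorPower.finrank_eq, Module.finrank_fin_fun]
        exact Nat.choose_eq_zero_of_lt (by omega)
      rw [Submodule.finrank_eq_zero.1 this]
      exact bot_le
  refine ⟨?_⟩
  rw [← top_le_iff.1 (h1.symm.le.trans h2)]
  exact Submodule.fg_biSup _ _ fun k _ => Module.Finite.iff_fg.1 inferInstance

/-- The spin module `Σ = Λ• L'`, the exterior algebra on the complex vector space `L'` with basis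
`y_1, …, y_n`, where `y_p = (E_p + i F_p) / √2` is the `p`-th standard vector of `ℂⁿ`. -/
def Spinor (n : ℕ) : Type := ExteriorAlgebra ℂ (Fin n → ℂ)

instance : AddCommGroup (Spinor n) := inferInstanceAs (AddCommGroup (ExteriorAlgebra ℂ (Fin n → ℂ)))
instance : Module ℂ (Spinor n) := inferInstanceAs (Module ℂ (ExteriorAlgebra ℂ (Fin n → ℂ)))
instance : One (Spinor n) := inferInstanceAs (One (ExteriorAlgebra ℂ (Fin n → ℂ)))
instance : Module.Finite ℂ (Spinor n) :=
  inferInstanceAs (Module.Finite ℂ (ExteriorAlgebra ℂ (Fin n → ℂ)))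

/-- An auxiliary norm on the finite-dimensional space `Σ` (the supremum norm in some basis). It only
serves to speak of derivatives, which do not depend on the choice of a norm. -/
instance : NormedAddCommGroup (Spinor n) :=
  NormedAddCommGroup.induced (Spinor n) _ (Module.finBasis ℂ (Spinor n)).equivFun
    (Module.finBasis ℂ (Spinor n)).equivFun.injective

instance : NormedSpace ℂ (Spinor n) :=
  NormedSpace.induced ℂ (Spinor n) _ (Module.finBasis ℂ (Spinor n)).equivFun

/-- The operator `y_p ∧ ·`. -/
def wedgeY (p : Fin n) : Spinor n →ₗ[ℂ] Spinor n :=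
  LinearMap.mulLeft ℂ (A := ExteriorAlgebra ℂ (Fin n → ℂ)) (ExteriorAlgebra.ι ℂ (Pi.single p 1))

/-- The operator `x_p ⌟ ·`: the antiderivation with `x_p ⌟ y_q = δ_{pq}`, the value at
`(x_p, y_q)` of the complex bilinear extension of the inner product, for `x_p = (E_p - i F_p) / √2`. -/
def contractX (p : Fin n) : Spinor n →ₗ[ℂ] Spinor n :=
  CliffordAlgebra.contractLeft (Q := (0 : QuadraticForm ℂ (Fin n → ℂ)))
    (LinearMap.proj p : (Fin n → ℂ) →ₗ[ℂ] ℂ)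

/-- The parity operator `η ↦ η_even - η_odd`. -/
def parity : Spinor n →ₗ[ℂ] Spinor n :=
  (CliffordAlgebra.involute (Q := (0 : QuadraticForm ℂ (Fin n → ℂ)))).toLinearMap

/-- The Clifford action of an orthonormal basis `(Z, E_1, F_1, …, E_n, F_n)` on `Σ`:
`Z · η = i (η_even - η_odd)`, `E_p · η = i (x_p ⌟ η + y_p ∧ η)`, `F_p · η = y_p ∧ η - x_p ⌟ η`. -/
def heisGamma : HeisIndex n → Spinor n →ₗ[ℂ] Spinor n
  | Sum.inl _ => Complex.I • parity
  | Sum.inr (Sum.inl p) => Complex.I • (contractX p + wedgeY p)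
  | Sum.inr (Sum.inr p) => wedgeY p - contractX p

theorem wedgeY_wedgeY (p q : Fin n) (η : Spinor n) :
    wedgeY p (wedgeY q η) = -wedgeY q (wedgeY p η) := by
  rw [eq_neg_iff_add_eq_zero]
  have h := ExteriorAlgebra.ι_add_mul_swap (R := ℂ) (M := Fin n → ℂ) (Pi.single p 1) (Pi.single q 1)
  have h' (z : ExteriorAlgebra ℂ (Fin n → ℂ)) :
      ExteriorAlgebra.ι ℂ (Pi.single p 1) * (ExteriorAlgebra.ι ℂ (Pi.single q 1) * z) +
        ExteriorAlgebra.ι ℂ (Pi.single q 1) * (ExteriorAlgebra.ι ℂ (Pi.single p 1) * z) = 0 := by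
    rw [← mul_assoc, ← mul_assoc, ← add_mul, h, zero_mul]
  exact h' η

theorem contractX_contractX (p q : Fin n) (η : Spinor n) :
    contractX p (contractX q η) = -contractX q (contractX p η) :=
  CliffordAlgebra.contractLeft_comm (Q := (0 : QuadraticForm ℂ (Fin n → ℂ)))
    (d := (LinearMap.proj p : (Fin n → ℂ) →ₗ[ℂ] ℂ))
    (d' := (LinearMap.proj q : (Fin n → ℂ) →ₗ[ℂ] ℂ)) η

theorem contractX_wedgeY (p q : Fin n) (η : Spinor n) :
    contractX p (wedgeY q η) = (if p = q then (1 : ℂ) else 0) • η - wedgeY q (contractX p η) := by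
  have h := CliffordAlgebra.contractLeft_ι_mul (Q := (0 : QuadraticForm ℂ (Fin n → ℂ)))
    (d := (LinearMap.proj p : (Fin n → ℂ) →ₗ[ℂ] ℂ)) (Pi.single q 1) η
  rw [show (LinearMap.proj p : (Fin n → ℂ) →ₗ[ℂ] ℂ) (Pi.single q 1) = if p = q then (1 : ℂ) else 0
    from Pi.single_apply q 1 p] at h
  exact h

theorem parity_parity (η : Spinor n) : parity (parity η) = η :=
  CliffordAlgebra.involute_involute (Q := (0 : QuadraticForm ℂ (Fin n → ℂ))) η

theorem parity_wedgeY (p : Fin n) (η : Spinor n) : parity (wedgeY p η) = -wedgeY p (parity η) := by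
  have h := map_mul (CliffordAlgebra.involute (Q := (0 : QuadraticForm ℂ (Fin n → ℂ))))
    (CliffordAlgebra.ι _ (Pi.single p 1)) η
  rw [CliffordAlgebra.involute_ι, neg_mul] at h
  exact h

theorem parity_contractX (p : Fin n) (η : Spinor n) :
    parity (contractX p η) = -contractX p (parity η) := by
  let Q : QuadraticForm ℂ (Fin n → ℂ) := 0
  let d : Module.Dual ℂ (Fin n → ℂ) := LinearMap.proj p
  suffices h : ∀ z : CliffordAlgebra Q, CliffordAlgebra.involute (CliffordAlgebra.contractLeft d z) =
      -CliffordAlgebra.contractLeft d (CliffordAlgebra.involute z) from h η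
  intro z
  induction z using CliffordAlgebra.left_induction with
  | algebraMap r => simp
  | add x y hx hy => simp only [map_add, hx, hy, neg_add]
  | ι_mul x m hx =>
    simp only [map_mul, CliffordAlgebra.contractLeft_ι_mul, map_sub, map_smul,
      CliffordAlgebra.involute_ι, neg_mul, map_neg, hx, mul_neg, neg_neg]

/-- The operators `heisGamma i` satisfy the Clifford relations `e_i e_j + e_j e_i = - 2 δ_{ij}`. -/
theorem heisGamma_clifford (i j : HeisIndex n) (η : Spinor n) :
    heisGamma i (heisGamma j η) + heisGamma j (heisGamma i η) = if i = j then (-2 : ℂ) • η else 0 := by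
  have hI (z : Spinor n) : Complex.I • Complex.I • z = -z := by
    rw [smul_smul, Complex.I_mul_I, neg_one_smul]
  rcases i with i | p | p <;> rcases j with j | q | q <;>
    simp only [heisGamma, LinearMap.smul_apply, LinearMap.add_apply, LinearMap.sub_apply, map_smul,
      map_add, map_sub, hI, parity_parity, parity_wedgeY, parity_contractX, contractX_wedgeY,
      reduceCtorEq, if_false, Sum.inl.injEq, Sum.inr.injEq, smul_add, smul_sub]
  · simp; module
  · module
  · module
  · module
  · rw [wedgeY_wedgeY p q, contractX_contractX p q]
    by_cases h : p = q
    · simp [h]; module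
    · simp [h, Ne.symm h]; module
  · rw [wedgeY_wedgeY p q, contractX_contractX p q]
    by_cases h : p = q
    · simp [h]; module
    · simp [h, Ne.symm h]; module
  · module
  · rw [wedgeY_wedgeY p q, contractX_contractX p q]
    by_cases h : p = q
    · simp [h]; module
    · simp [h, Ne.symm h]; module
  · rw [wedgeY_wedgeY p q, contractX_contractX p q]
    by_cases h : p = q
    · simp [h]; module
    · simp [h, Ne.symm h]; module

/-- The invariant spinor field on `H_{2n+1}` determined by `s ∈ Σ`: the constant map `s`. -/
def invariantSpinor (s : Spinor n) : Heisenberg n → Spinor n := fun _ => s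

/-- The left-invariant frame determined by vectors `u i` of the Lie algebra. -/
def leftInvFrame (u : HeisIndex n → HeisAlg n) (i : HeisIndex n) (x : Heisenberg n) :
    TangentSpace 𝓘(ℝ, HeisModel n) x :=
  mulInvariantVectorField (u i) x

/-- `g` is a left-invariant metric on `H_{2n+1}` for which the basis `u` of `𝔥_{2n+1}` is orthonormal. -/
def IsLeftInvariantWith (g : RiemMetric 𝓘(ℝ, HeisModel n) (Heisenberg n))
    (u : HeisIndex n → HeisAlg n) : Prop :=
  IsLeftInvariant g ∧ ∀ i j, g.inner 1 (u i) (u j) = if i = j then 1 else 0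

/-- Connections on the tangent bundle of `H_{2n+1}`. -/
abbrev HeisConnection (n : ℕ) : Type _ :=
  CovariantDerivative 𝓘(ℝ, HeisModel n) (HeisModel n)
    (fun x : Heisenberg n => TangentSpace 𝓘(ℝ, HeisModel n) x)

/-- Endomorphism fields of the tangent bundle of `H_{2n+1}`. -/
abbrev HeisEndo (n : ℕ) : Type _ :=
  ∀ x : Heisenberg n, TangentSpace 𝓘(ℝ, HeisModel n) x →L[ℝ] TangentSpace 𝓘(ℝ, HeisModel n) x

/-- `λ_p = (1/4) √(c / (a_p b_p))`. -/
def heisLambda (a b : Fin n → ℝ) (c : ℝ) (p : Fin n) : ℝ := 1 / 4 * √(c / (a p * b p))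

end Spinor

end

/-!
In a left-invariant orthonormal frame the structure functions are constant, and Koszul's formula
turns `(*)` into the Levi-Civita coefficients. For `X = ∑ X_i e_i` the spin derivative of the
constant spinor `1` is therefore `∑ X_i Γ_i · 1`, with constant elements `Γ_Z = -∑ λ_p E_p F_p`,
`Γ_{E_p} = λ_p F_p Z` and `Γ_{F_p} = -λ_p E_p Z` of the Clifford algebra. On the spinor `1` one has
`E_p F_p · 1 = Z · 1`, `F_p Z · 1 = E_p · 1` and `E_p Z · 1 = -F_p · 1`, so that each `Γ_i · 1` is a
multiple of `e_i · 1`, and the endomorphism that is diagonal in the frame, with entries `λ_p` on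
`E_p`, `F_p` and `-∑ λ_q` on `Z`, works. It is the only one, because the spinors `e_i · 1` are
linearly independent over the reals.
-/

noncomputable section

section SmulRight

variable {𝕜 : Type*} [NontriviallyNormedField 𝕜]
  {W : Type*} [NormedAddCommGroup W] [NormedSpace 𝕜 W] {H : Type*} [TopologicalSpace H]
  {I : ModelWithCorners 𝕜 W H} {M : Type*} [TopologicalSpace M] [ChartedSpace H M]
  {F₁ : Type*} [NormedAddCommGroup F₁] [NormedSpace 𝕜 F₁]
  {E₁ : M → Type*} [TopologicalSpace (Bundle.TotalSpace F₁ E₁)] [∀ x, TopologicalSpace (E₁ x)]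
  [∀ x, AddCommGroup (E₁ x)] [∀ x, Module 𝕜 (E₁ x)] [FiberBundle F₁ E₁] [VectorBundle 𝕜 F₁ E₁]
  {F₂ : Type*} [NormedAddCommGroup F₂] [NormedSpace 𝕜 F₂]
  {E₂ : M → Type*} [TopologicalSpace (Bundle.TotalSpace F₂ E₂)] [∀ x, TopologicalSpace (E₂ x)]
  [∀ x, AddCommGroup (E₂ x)] [∀ x, Module 𝕜 (E₂ x)] [FiberBundle F₂ E₂] [VectorBundle 𝕜 F₂ E₂]
  [∀ x, IsTopologicalAddGroup (E₂ x)] [∀ x, ContinuousSMul 𝕜 (E₂ x)]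

theorem contMDiffAt_smulRight_section {k : WithTop ℕ∞} {x₀ : M} {φ : ∀ x, E₁ x →L[𝕜] 𝕜}
    {s : ∀ x, E₂ x}
    (hφ : ContMDiffAt I (I.prod 𝓘(𝕜, F₁ →L[𝕜] 𝕜)) k (fun x => Bundle.TotalSpace.mk' (F₁ →L[𝕜] 𝕜)
      (E := fun x => E₁ x →L[𝕜] Bundle.Trivial M 𝕜 x) x (φ x)) x₀)
    (hs : ContMDiffAt I (I.prod 𝓘(𝕜, F₂)) k (fun x => Bundle.TotalSpace.mk' F₂ x (s x)) x₀) :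
    ContMDiffAt I (I.prod 𝓘(𝕜, F₁ →L[𝕜] F₂)) k (fun x => Bundle.TotalSpace.mk' (F₁ →L[𝕜] F₂)
      (E := fun x => E₁ x →L[𝕜] E₂ x) x ((φ x).smulRight (s x))) x₀ := by
  rw [contMDiffAt_hom_bundle] at hφ ⊢
  rw [Bundle.contMDiffAt_section] at hs
  refine ⟨contMDiffAt_id, ?_⟩
  refine (((ContinuousLinearMap.smulRightL 𝕜 F₁ F₂).contMDiff.contMDiffAt.comp x₀
    hφ.2).clm_apply hs).congr_of_eventuallyEq ?_
  filter_upwards [(trivializationAt F₂ E₂ x₀).open_baseSet.mem_nhds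
    (FiberBundle.mem_baseSet_trivializationAt' x₀)] with x hx
  ext v
  simp [ContinuousLinearMap.inCoordinates, Bundle.Trivialization.coe_linearMapAt_of_mem _ hx]

end SmulRight

section Koszul

variable {ι : Type*}

/-- The right-hand side of Koszul's formula for an orthonormal frame with structure functions
`c i j k = g([e_i, e_j], e_k)`: the coefficients `g(∇_{e_i} e_j, e_k)` of the Levi-Civita
connection. -/
def koszul (c : ι → ι → ι → ℝ) (i j k : ι) : ℝ :=
  (c i j k - c j k i + c k i j) / 2

variable {c : ι → ι → ι → ℝ}

theorem koszul_sub_swap_left (hc : ∀ i j k, c i j k = -c j i k) (i j k : ι) :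
    koszul c i j k - koszul c j i k = c i j k := by
  simp only [koszul]
  linarith [hc j i k, hc j k i, hc k i j]

theorem koszul_swap_right (hc : ∀ i j k, c i j k = -c j i k) (i j k : ι) :
    koszul c i j k = -koszul c i k j := by
  simp only [koszul]
  linarith [hc i k j, hc k j i, hc j i k]

theorem eq_koszul {Γ : ι → ι → ι → ℝ} (htors : ∀ i j k, Γ i j k - Γ j i k = c i j k)
    (hskew : ∀ i j k, Γ i j k = -Γ i k j) : Γ = koszul c := by
  funext i j k
  simp only [koszul]
  linarith [htors i j k, htors j k i, htors k i j, hskew i j k, hskew j k i, hskew k i j]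

end Koszul

theorem sum_skew_mul_add {ι : Type*} [Fintype ι] {B : ι → ι → ℝ} (hB : ∀ j k, B j k = -B k j)
    (a b : ι → ℝ) :
    ∑ k, (∑ j, B j k * a j) * b k + ∑ k, (∑ j, B j k * b j) * a k = 0 := by
  simp only [Finset.sum_mul]
  rw [Finset.sum_comm (f := fun k j => B j k * a j * b k), ← Finset.sum_add_distrib]
  refine Finset.sum_eq_zero fun j _ => ?_
  rw [← Finset.sum_add_distrib]
  exact Finset.sum_eq_zero fun k _ => by rw [hB j k]; ring

theorem mvfderiv_finsetSum {𝕜 E H M F κ : Type*} [NontriviallyNormedField 𝕜] [NormedAddCommGroup E]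
    [NormedSpace 𝕜 E] [TopologicalSpace H] {I : ModelWithCorners 𝕜 E H} [TopologicalSpace M]
    [ChartedSpace H M] [NormedAddCommGroup F] [NormedSpace 𝕜 F] {s : Finset κ} {f : κ → M → F}
    {x : M} (hf : ∀ k ∈ s, MDiffAt (f k) x) :
    mvfderiv I (∑ k ∈ s, f k) x = ∑ k ∈ s, mvfderiv I (f k) x := by
  suffices hsum : MDiffAt (∑ k ∈ s, f k) x ∧
      mvfderiv I (∑ k ∈ s, f k) x = ∑ k ∈ s, mvfderiv I (f k) x from hsum.2
  induction s using Finset.cons_induction with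
  | empty => exact ⟨mdifferentiableAt_const, by simp⟩
  | cons k s hk ih =>
    rw [Finset.forall_mem_cons] at hf
    obtain ⟨hdiff, hderiv⟩ := ih hf.2
    rw [Finset.sum_cons, Finset.sum_cons, mvfderiv_add hf.1 hdiff, hderiv]
    exact ⟨hf.1.add hdiff, rfl⟩

section OrthonormalFrame

variable {V : Type*} [NormedAddCommGroup V] [NormedSpace ℝ V] {H : Type*} [TopologicalSpace H]
  {I : ModelWithCorners ℝ V H} {M : Type*} [TopologicalSpace M] [ChartedSpace H M]
  [IsManifold I ∞ M] {ι : Type*}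

theorem RiemMetric.mdifferentiableAt_inner (g : RiemMetric I M) {σ τ : ∀ x : M, TangentSpace I x}
    {x : M} (hσ : MDiffAt (T% σ) x) (hτ : MDiffAt (T% τ) x) :
    MDiffAt (fun y => g.inner y (σ y) (τ y)) x := by
  have h := MDifferentiableAt.clm_bundle_apply₂ (E₃ := Bundle.Trivial M ℝ) (F₁ := V) (F₂ := V)
    (F₃ := ℝ) (g.contMDiff.mdifferentiableAt (x := x) (by simp)) hσ hτ
  rwa [mdifferentiableAt_section] at h

/-- A smooth global frame of the tangent bundle that is orthonormal for `g` at each point. -/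
structure IsOrthonormalFrame [DecidableEq ι] (g : RiemMetric I M)
    (e : ι → ∀ x : M, TangentSpace I x) : Prop where
  isFrame : IsLocalFrameOn I V ∞ e Set.univ
  inner_eq : ∀ (x : M) i j, g.inner x (e i x) (e j x) = if i = j then 1 else 0

/-- The functions `g([e_i, e_j], e_k)` of a frame `e`; if `e` is orthonormal, these are its
structure functions. -/
def structureCoeff (g : RiemMetric I M) (e : ι → ∀ x : M, TangentSpace I x) (x : M)
    (i j k : ι) : ℝ :=
  g.inner x (VectorField.mlieBracket I (e i) (e j) x) (e k x)

theorem structureCoeff_swap (g : RiemMetric I M) (e : ι → ∀ x : M, TangentSpace I x) (x : M)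
    (i j k : ι) : structureCoeff g e x i j k = -structureCoeff g e x j i k := by
  rw [structureCoeff, VectorField.mlieBracket_swap_apply, map_neg, neg_apply, structureCoeff]

/-- The connection form `g(∇_X e_j, e_k)` of the Levi-Civita connection `∇` in an orthonormal frame
`e`, as given by Koszul's formula. -/
def connectionForm [Fintype ι] (g : RiemMetric I M) (e : ι → ∀ x : M, TangentSpace I x) (x : M)
    (X : TangentSpace I x) (j k : ι) : ℝ :=
  ∑ i, g.inner x X (e i x) * koszul (structureCoeff g e x) i j k

theorem connectionForm_swap [Fintype ι] (g : RiemMetric I M) (e : ι → ∀ x : M, TangentSpace I x)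
    (x : M) (X : TangentSpace I x) (j k : ι) :
    connectionForm g e x X j k = -connectionForm g e x X k j := by
  simp only [connectionForm, koszul_swap_right (structureCoeff_swap g e x) _ j k, mul_neg,
    Finset.sum_neg_distrib]

namespace IsOrthonormalFrame

variable [DecidableEq ι] {g : RiemMetric I M} {e : ι → ∀ x : M, TangentSpace I x}

theorem mdifferentiableAt (h : IsOrthonormalFrame g e) (i : ι) (x : M) : MDiffAt (T% (e i)) x :=
  (h.isFrame.contMDiffAt isOpen_univ (Set.mem_univ x) i).mdifferentiableAt (by simp)

theorem mvfderiv_inner_frame (h : IsOrthonormalFrame g e) (i j : ι) (x : M) :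
    mvfderiv I (fun y => g.inner y (e i y) (e j y)) x = 0 := by
  simp only [h.inner_eq]
  exact mvfderiv_const _

theorem sum_inner_smul [Fintype ι] (h : IsOrthonormalFrame g e) (x : M) (X : TangentSpace I x) :
    ∑ i, g.inner x X (e i x) • e i x = X := by
  have hid : ∑ i, (g.inner x (e i x)).toLinearMap.smulRight (e i x) = LinearMap.id := by
    refine (h.isFrame.toBasisAt (Set.mem_univ x)).ext fun j => ?_
    simp [h.inner_eq]
  simpa [g.symm x X] using LinearMap.congr_fun hid X

theorem ext_inner [Finite ι] (h : IsOrthonormalFrame g e) {x : M} {X Y : TangentSpace I x}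
    (hXY : ∀ i, g.inner x X (e i x) = g.inner x Y (e i x)) : X = Y := by
  cases nonempty_fintype ι
  rw [← h.sum_inner_smul x X, ← h.sum_inner_smul x Y]
  simp only [hXY]

theorem inner_of_isLeviCivita [FiniteDimensional ℝ V] (h : IsOrthonormalFrame g e)
    {nabla : CovariantDerivative I V (fun x : M => TangentSpace I x)}
    (hn : IsLeviCivita g nabla) (x : M) (i j k : ι) :
    g.inner x (nabla (e j) x (e i x)) (e k x) = koszul (structureCoeff g e x) i j k := by
  have : CompleteSpace V := FiniteDimensional.complete ℝ V
  refine congrFun₃ (eq_koszul (Γ := fun i j k => g.inner x (nabla (e j) x (e i x)) (e k x))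
    (fun i j k => ?_) fun i j k => ?_) i j k
  · rw [structureCoeff, ← (CovariantDerivative.torsion_eq_zero_iff nabla).1 hn.1
      (h.mdifferentiableAt i x) (h.mdifferentiableAt j x), map_sub, sub_apply]
  · have hmetric := hn.2 (e j) (e k) x (e i x) (h.mdifferentiableAt j x) (h.mdifferentiableAt k x)
    rw [h.mvfderiv_inner_frame, g.symm x (e j x)] at hmetric
    exact eq_neg_of_add_eq_zero_left hmetric.symm

variable [Fintype ι]

theorem inner_eq_sum (h : IsOrthonormalFrame g e) (x : M) (X Y : TangentSpace I x) :
    g.inner x X Y = ∑ i, g.inner x X (e i x) * g.inner x Y (e i x) := by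
  conv_lhs => rw [← h.sum_inner_smul x Y]
  simp [mul_comm]

/-- The connection for which the frame `e` is parallel. -/
def flatConnection (h : IsOrthonormalFrame g e) :
    CovariantDerivative I V (fun x : M => TangentSpace I x) where
  toFun σ x := ∑ k, (mvfderiv I (fun y => g.inner y (σ y) (e k y)) x).smulRight (e k x)
  isCovariantDerivativeOnUniv :=
    { add := fun {σ τ} x hσ hτ _ => by
        have hadd k : (fun y => g.inner y ((σ + τ) y) (e k y)) =
            (fun y => g.inner y (σ y) (e k y)) + fun y => g.inner y (τ y) (e k y) := by
          ext y; simp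
        simp only [hadd, mvfderiv_add (g.mdifferentiableAt_inner hσ (h.mdifferentiableAt _ x))
          (g.mdifferentiableAt_inner hτ (h.mdifferentiableAt _ x))]
        ext X
        simp [add_smul, Finset.sum_add_distrib]
      leibniz := fun {σ f} x hσ hf _ => by
        have hsmul k : (fun y => g.inner y ((f • σ) y) (e k y)) =
            f • fun y => g.inner y (σ y) (e k y) := by
          ext y; simp
        simp only [hsmul,
          mvfderiv_smul hf (g.mdifferentiableAt_inner hσ (h.mdifferentiableAt _ x))]
        ext X
        have hX : mvfderiv I f x X • σ x =
            ∑ k, (mvfderiv I f x X * g.inner x (σ x) (e k x)) • e k x := by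
          conv_lhs => rw [← h.sum_inner_smul x (σ x)]
          simp only [Finset.smul_sum, smul_smul]
        simp [hX, add_smul, Finset.sum_add_distrib, Finset.smul_sum, smul_smul] }

/-- The Levi-Civita connection, obtained from the flat connection of the frame by adding the
one-form with values in endomorphisms with coefficients given by Koszul's formula. -/
def leviCivita (h : IsOrthonormalFrame g e) :
    CovariantDerivative I V (fun x : M => TangentSpace I x) :=
  h.flatConnection.addOneForm fun x => ∑ j, ∑ i, ∑ k,
    (g.inner x (e j x)).smulRight
      ((koszul (structureCoeff g e x) i j k • g.inner x (e i x)).smulRight (e k x))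

theorem inner_leviCivita (h : IsOrthonormalFrame g e) (σ : ∀ x : M, TangentSpace I x) (x : M)
    (X : TangentSpace I x) (k : ι) :
    g.inner x (h.leviCivita σ x X) (e k x) =
      mvfderiv I (fun y => g.inner y (σ y) (e k y)) x X +
        ∑ j, connectionForm g e x X j k * g.inner x (σ x) (e j x) := by
  simp [leviCivita, flatConnection, connectionForm, CovariantDerivative.addOneForm, h.inner_eq,
    g.symm x X, g.symm x (σ x), Finset.mul_sum, mul_comm, mul_left_comm]

theorem inner_leviCivita_frame (h : IsOrthonormalFrame g e) (x : M) (i j k : ι) :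
    g.inner x (h.leviCivita (e j) x (e i x)) (e k x) = koszul (structureCoeff g e x) i j k := by
  rw [h.inner_leviCivita, h.mvfderiv_inner_frame]
  simp [connectionForm, h.inner_eq]

theorem mvfderiv_inner_eq_sum (h : IsOrthonormalFrame g e) {σ τ : ∀ x : M, TangentSpace I x} {x : M}
    (hσ : MDiffAt (T% σ) x) (hτ : MDiffAt (T% τ) x) (X : TangentSpace I x) :
    mvfderiv I (fun y => g.inner y (σ y) (τ y)) x X =
      ∑ k, (mvfderiv I (fun y => g.inner y (σ y) (e k y)) x X * g.inner x (τ x) (e k x) +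
        g.inner x (σ x) (e k x) * mvfderiv I (fun y => g.inner y (τ y) (e k y)) x X) := by
  have hsum : (fun y => g.inner y (σ y) (τ y)) = ∑ k,
      (fun y => g.inner y (σ y) (e k y)) * fun y => g.inner y (τ y) (e k y) := by
    ext y
    simpa using h.inner_eq_sum y (σ y) (τ y)
  have hσ' k := g.mdifferentiableAt_inner hσ (h.mdifferentiableAt k x)
  have hτ' k := g.mdifferentiableAt_inner hτ (h.mdifferentiableAt k x)
  rw [hsum, mvfderiv_finsetSum fun k _ => (hσ' k).mul (hτ' k)]
  simp [mvfderiv_mul (hσ' _) (hτ' _), mul_comm, add_comm]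

variable [FiniteDimensional ℝ V]

theorem isLeviCivita_leviCivita (h : IsOrthonormalFrame g e) : IsLeviCivita g h.leviCivita := by
  have : CompleteSpace V := FiniteDimensional.complete ℝ V
  refine ⟨?_, fun σ τ x X hσ hτ => ?_⟩
  · ext1 x
    let B := h.isFrame.toBasisAt (Set.mem_univ x)
    refine ContinuousLinearMap.coe_injective (B.ext fun i => ?_)
    refine ContinuousLinearMap.coe_injective (B.ext fun j => ?_)
    simp only [B, IsLocalFrameOn.toBasisAt_coe, ContinuousLinearMap.coe_coe]
    rw [CovariantDerivative.torsion_apply _ (h.mdifferentiableAt i x) (h.mdifferentiableAt j x)]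
    refine h.ext_inner fun k => ?_
    simpa only [map_sub, sub_apply, inner_leviCivita_frame, sub_eq_zero, map_zero, zero_apply,
      Pi.zero_apply, structureCoeff]
      using koszul_sub_swap_left (structureCoeff_swap g e x) i j k
  · rw [h.mvfderiv_inner_eq_sum hσ hτ, g.symm x (σ x), h.inner_eq_sum x (h.leviCivita σ x X),
      h.inner_eq_sum x (h.leviCivita τ x X)]
    have hskew := sum_skew_mul_add (connectionForm_swap g e x X)
      (fun k => g.inner x (σ x) (e k x)) fun k => g.inner x (τ x) (e k x)
    simp only [h.inner_leviCivita, add_mul, Finset.sum_add_distrib] at hskew ⊢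
    simp only [mul_comm (g.inner x (σ x) (e _ x)) (mvfderiv _ _ _ _)]
    linear_combination -hskew

theorem inner_of_isLeviCivita_eq_connectionForm (h : IsOrthonormalFrame g e)
    {nabla : CovariantDerivative I V (fun x : M => TangentSpace I x)}
    (hn : IsLeviCivita g nabla) (x : M) (X : TangentSpace I x) (j k : ι) :
    g.inner x (nabla (e j) x X) (e k x) = connectionForm g e x X j k := by
  conv_lhs => rw [← h.sum_inner_smul x X]
  simp [h.inner_of_isLeviCivita hn, connectionForm]

end IsOrthonormalFrame
end OrthonormalFrame

section GenKilling

variable {V : Type*} [NormedAddCommGroup V] [NormedSpace ℝ V] {H : Type*} [TopologicalSpace H]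
  {I : ModelWithCorners ℝ V H} {M : Type*} [TopologicalSpace M] [ChartedSpace H M]
  [IsManifold I ∞ M] {ι : Type*} [Fintype ι]
  {S : Type*} [NormedAddCommGroup S] [NormedSpace ℂ S] {γ : ι → S →ₗ[ℂ] S} {s : S}

theorem spinLift_sum_mul {κ : Type*} [Fintype κ] (γ : ι → S →ₗ[ℂ] S) (r : κ → ℝ)
    (B : κ → ι → ι → ℝ) (s : S) :
    spinLift γ (fun j k => ∑ i, r i * B i j k) s = ∑ i, (r i : ℂ) • spinLift γ (B i) s := by
  have hcomm (f : κ → ι → ι → S) : ∑ j, ∑ k, ∑ i, f i j k = ∑ i, ∑ j, ∑ k, f i j k := by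
    rw [Finset.sum_comm (f := fun i j => ∑ k, f i j k)]
    exact Finset.sum_congr rfl fun j _ => Finset.sum_comm
  simp only [spinLift, Complex.ofReal_sum, Complex.ofReal_mul, Finset.sum_smul, Finset.smul_sum]
  rw [hcomm]
  refine Finset.sum_congr rfl fun i _ => Finset.sum_congr rfl fun j _ =>
    Finset.sum_congr rfl fun k _ => ?_
  module

theorem spinLift_mul (γ : ι → S →ₗ[ℂ] S) (r : ℝ) (B : ι → ι → ℝ) (s : S) :
    spinLift γ (fun j k => r * B j k) s = (r : ℂ) • spinLift γ B s := by
  simpa only [Finset.univ_unique, Finset.sum_singleton] using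
    spinLift_sum_mul γ (fun _ : Unit => r) (fun _ => B) s

/-- The coefficients of the elementary skew endomorphism `e_i ∧ e_j`, with `e_i ↦ e_j` and
`e_j ↦ -e_i`, as in `spinLift`. -/
def skewSingle [DecidableEq ι] (i j k m : ι) : ℝ :=
  (if i = k then if j = m then 1 else 0 else 0) - if j = k then if i = m then 1 else 0 else 0

theorem spinLift_skewSingle [DecidableEq ι] {i j : ι} (h : γ j (γ i s) = -γ i (γ j s)) :
    spinLift γ (skewSingle i j) s = (1 / 2 : ℂ) • γ i (γ j s) := by
  simp only [spinLift, skewSingle, Complex.ofReal_sub, apply_ite Complex.ofReal,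
    Complex.ofReal_one, Complex.ofReal_zero, sub_smul, ite_smul, zero_smul,
    Finset.sum_sub_distrib, Finset.sum_ite_irrel, Finset.sum_const_zero, Finset.sum_ite_eq,
    Finset.mem_univ, if_true, h]
  module

/-- The endomorphism field with `e_i ↦ κ_i e_i`, for an orthonormal frame `e`. -/
def diagEndo (g : RiemMetric I M) (e : ι → ∀ x : M, TangentSpace I x) (κ : ι → ℝ) (x : M) :
    TangentSpace I x →L[ℝ] TangentSpace I x :=
  ∑ i, κ i • (g.inner x (e i x)).smulRight (e i x)

namespace IsOrthonormalFrame

variable [DecidableEq ι] {g : RiemMetric I M} {e : ι → ∀ x : M, TangentSpace I x} {κ : ι → ℝ}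

theorem inner_diagEndo (h : IsOrthonormalFrame g e) (κ : ι → ℝ) (x : M) (X : TangentSpace I x)
    (i : ι) : g.inner x (diagEndo g e κ x X) (e i x) = κ i * g.inner x X (e i x) := by
  simp [diagEndo, h.inner_eq, g.symm x X]

theorem inner_diagEndo_left (h : IsOrthonormalFrame g e) (κ : ι → ℝ) (x : M)
    (X Y : TangentSpace I x) :
    g.inner x (diagEndo g e κ x X) Y = g.inner x X (diagEndo g e κ x Y) := by
  rw [h.inner_eq_sum, h.inner_eq_sum x X]
  simp only [h.inner_diagEndo, mul_assoc, mul_left_comm]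

theorem contMDiff_diagEndo (h : IsOrthonormalFrame g e) (κ : ι → ℝ) :
    ContMDiff I (I.prod 𝓘(ℝ, V →L[ℝ] V)) ∞ (fun x => Bundle.TotalSpace.mk' (V →L[ℝ] V)
      (E := fun x : M => TangentSpace I x →L[ℝ] TangentSpace I x) x (diagEndo g e κ x)) := by
  intro x
  have he i := h.isFrame.contMDiffAt isOpen_univ (Set.mem_univ x) i
  refine ContMDiffAt.sum_section fun i _ => ContMDiffAt.const_smul_section ?_
  exact contMDiffAt_smulRight_section
    (g.contMDiff.contMDiffAt.clm_bundle_apply (E₂ := fun x => TangentSpace I x →L[ℝ] ℝ) (he i))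
    (he i)

variable [FiniteDimensional ℝ V]
  {nabla : CovariantDerivative I V (fun x : M => TangentSpace I x)}

theorem spinConnection_const (h : IsOrthonormalFrame g e) (hn : IsLeviCivita g nabla) (x : M)
    (X : TangentSpace I x) :
    spinConnection g nabla e γ (fun _ => s) x X =
      ∑ i, (g.inner x X (e i x) : ℂ) • spinLift γ (koszul (structureCoeff g e x) i) s := by
  simp [spinConnection, h.inner_of_isLeviCivita_eq_connectionForm hn, connectionForm,
    spinLift_sum_mul, mvfderiv_const]

theorem isGenKillingWith_diagEndo (h : IsOrthonormalFrame g e) (hn : IsLeviCivita g nabla)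
    (hκ : ∀ x i, spinLift γ (koszul (structureCoeff g e x) i) s = (κ i : ℂ) • γ i s) :
    IsGenKillingWith g nabla e γ (fun _ => s) (diagEndo g e κ) where
  smooth_spinor := contMDiff_const
  smooth_endo := h.contMDiff_diagEndo κ
  symm := h.inner_diagEndo_left κ
  eq x X := by
    rw [h.spinConnection_const hn]
    simp only [cliffordMul, hκ, h.inner_diagEndo, smul_smul, Complex.ofReal_mul, mul_comm]

theorem endo_frame_eq_smul (h : IsOrthonormalFrame g e) (hn : IsLeviCivita g nabla)
    (hκ : ∀ x i, spinLift γ (koszul (structureCoeff g e x) i) s = (κ i : ℂ) • γ i s)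
    (hγ : ∀ r : ι → ℝ, ∑ i, (r i : ℂ) • γ i s = 0 → r = 0)
    {A : ∀ x : M, TangentSpace I x →L[ℝ] TangentSpace I x}
    (hA : IsGenKillingWith g nabla e γ (fun _ => s) A) (x : M) (i : ι) :
    A x (e i x) = κ i • e i x := by
  have hspin : cliffordMul g e γ x (A x (e i x)) s = cliffordMul g e γ x (κ i • e i x) s := by
    rw [← hA.eq, h.spinConnection_const hn]
    simp [cliffordMul, h.inner_eq, hκ]
  rw [cliffordMul, cliffordMul, ← sub_eq_zero, ← Finset.sum_sub_distrib] at hspin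
  simp only [← sub_smul, ← Complex.ofReal_sub] at hspin
  exact h.ext_inner fun j => sub_eq_zero.1 (congrFun (hγ _ hspin) j)

theorem eigenvaluesAt_eq_range (h : IsOrthonormalFrame g e) (hn : IsLeviCivita g nabla)
    (hκ : ∀ x i, spinLift γ (koszul (structureCoeff g e x) i) s = (κ i : ℂ) • γ i s)
    (hγ : ∀ r : ι → ℝ, ∑ i, (r i : ℂ) • γ i s = 0 → r = 0)
    {A : ∀ x : M, TangentSpace I x →L[ℝ] TangentSpace I x}
    (hA : IsGenKillingWith g nabla e γ (fun _ => s) A) (x : M) :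
    eigenvaluesAt A x = Set.range κ := by
  let B := h.isFrame.toBasisAt (Set.mem_univ x)
  have hdiag : (A x : TangentSpace I x →ₗ[ℝ] TangentSpace I x) =
      Matrix.toLin B B (Matrix.diagonal κ) := by
    refine B.ext fun i => ?_
    rw [Matrix.toLin_self]
    simpa [B, Matrix.diagonal_apply] using h.endo_frame_eq_smul hn hκ hγ hA x i
  ext r
  rw [eigenvaluesAt, Set.mem_ofPred_eq, hdiag, hasEigenvalue_toLin_diagonal_iff, Set.mem_range]

end IsOrthonormalFrame

end GenKilling

theorem isVonNBounded_sum_sq_lt_one {E ι : Type*} [NormedAddCommGroup E] [NormedSpace ℝ E]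
    [FiniteDimensional ℝ E] [Fintype ι] {θ : ι → E →L[ℝ] ℝ} (hθ : ∀ X, (∀ i, θ i X = 0) → X = 0) :
    Bornology.IsVonNBounded ℝ {X : E | ∑ i, θ i X * θ i X < 1} := by
  obtain ⟨K, -, hK⟩ := (ContinuousLinearMap.pi θ).toLinearMap.exists_antilipschitzWith
    (LinearMap.ker_eq_bot'.2 fun X hX => hθ X fun i => congrFun hX i)
  rw [NormedSpace.isVonNBounded_iff]
  refine (hK.isBounded_preimage (Metric.isBounded_closedBall (x := 0) (r := 1))).subset
    fun X hX => ?_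
  rw [Set.mem_preimage, mem_closedBall_zero_iff, pi_norm_le_iff_of_nonneg zero_le_one]
  intro i
  have hi : θ i X * θ i X ≤ ∑ i, θ i X * θ i X :=
    Finset.single_le_sum (f := fun i => θ i X * θ i X) (fun i _ => mul_self_nonneg _)
      (Finset.mem_univ i)
  exact abs_le_one_iff_mul_self_le_one.2 (hi.trans (le_of_lt hX))

section Coframe

variable {V : Type*} [NormedAddCommGroup V] [NormedSpace ℝ V] [FiniteDimensional ℝ V]
  {H : Type*} [TopologicalSpace H] {I : ModelWithCorners ℝ V H} {M : Type*} [TopologicalSpace M]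
  [ChartedSpace H M] [IsManifold I ∞ M] {ι : Type*} [Fintype ι]

/-- The Riemannian metric `∑ i, θ_i ⊗ θ_i` of smooth one-forms `θ_i` spanning each cotangent
space. -/
def RiemMetric.ofCoframe (θ : ι → ∀ x : M, TangentSpace I x →L[ℝ] ℝ)
    (hθ : ∀ (x : M) (X : TangentSpace I x), (∀ i, θ i x X = 0) → X = 0)
    (hsmooth : ∀ i, ContMDiff I (I.prod 𝓘(ℝ, V →L[ℝ] ℝ)) ∞ (fun x =>
      Bundle.TotalSpace.mk' (V →L[ℝ] ℝ)
        (E := fun x : M => TangentSpace I x →L[ℝ] Bundle.Trivial M ℝ x) x (θ i x))) :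
    RiemMetric I M where
  inner x := ∑ i, (θ i x).smulRight (θ i x)
  symm x X Y := by simp [mul_comm]
  pos x X hX := by
    simp only [sum_apply, ContinuousLinearMap.smulRight_apply, smul_apply, smul_eq_mul]
    refine (Finset.sum_nonneg fun i _ => mul_self_nonneg _).lt_of_ne fun h =>
      hX (hθ x X fun i => ?_)
    exact mul_self_eq_zero.1 ((Finset.sum_eq_zero_iff_of_nonneg fun i _ => mul_self_nonneg _).1
      h.symm i (Finset.mem_univ i))
  isVonNBounded x := by
    have h : Bornology.IsVonNBounded ℝ {X : TangentSpace I x | ∑ i, θ i x X * θ i x X < 1} :=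
      isVonNBounded_sum_sq_lt_one (E := V) (hθ x)
    simpa using h
  contMDiff x := ContMDiffAt.sum_section fun i _ =>
    contMDiffAt_smulRight_section (hsmooth i x) (hsmooth i x)

theorem RiemMetric.ofCoframe_inner {θ : ι → ∀ x : M, TangentSpace I x →L[ℝ] ℝ} {hθ} {hsmooth}
    (x : M) (X Y : TangentSpace I x) :
    (RiemMetric.ofCoframe θ hθ hsmooth).inner x X Y = ∑ i, θ i x X * θ i x Y := by
  simp [RiemMetric.ofCoframe]

end Coframe

theorem IsOrthonormalFrame.of_card_eq_finrank {V : Type*} [NormedAddCommGroup V] [NormedSpace ℝ V]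
    [FiniteDimensional ℝ V] {H : Type*} [TopologicalSpace H] {I : ModelWithCorners ℝ V H}
    {M : Type*} [TopologicalSpace M] [ChartedSpace H M] [IsManifold I ∞ M] {ι : Type*} [Fintype ι]
    [DecidableEq ι] {g : RiemMetric I M} {e : ι → ∀ x : M, TangentSpace I x}
    (hcard : Fintype.card ι = Module.finrank ℝ V)
    (hsmooth : ∀ i, ContMDiff I I.tangent ∞ (fun x => (⟨x, e i x⟩ : TangentBundle I M)))
    (hinner : ∀ (x : M) i j, g.inner x (e i x) (e j x) = if i = j then 1 else 0) :
    IsOrthonormalFrame g e := by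
  have hli (x : M) : LinearIndependent ℝ (fun i => e i x) := by
    refine Fintype.linearIndependent_iff.2 fun r hr j => ?_
    simpa [hinner] using congrArg (fun X => g.inner x X (e j x)) hr
  have hspan (x : M) : Submodule.span ℝ (Set.range fun i => e i x) = ⊤ :=
    have : FiniteDimensional ℝ (TangentSpace I x) := inferInstanceAs (FiniteDimensional ℝ V)
    (hli x).span_eq_top_of_card_eq_finrank' hcard
  exact ⟨⟨fun {x} _ => hli x, fun {x} _ => (hspan x).ge, fun i => (hsmooth i).contMDiffOn⟩, hinner⟩

section LieGroup

variable {V : Type*} [NormedAddCommGroup V] [NormedSpace ℝ V] {H : Type*} [TopologicalSpace H]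
  {I : ModelWithCorners ℝ V H} {G : Type*} [TopologicalSpace G] [ChartedSpace H G] [Group G]

/-- The left-invariant one-form with value `l` at the identity. -/
def mulInvariantForm (l : GroupLieAlgebra I G →L[ℝ] ℝ) (x : G) : TangentSpace I x →L[ℝ] ℝ :=
  l.comp (mfderiv I I (x⁻¹ * ·) x)

theorem mulInvariantForm_one (l : GroupLieAlgebra I G →L[ℝ] ℝ) : mulInvariantForm l 1 = l := by
  have hid : ((1 : G)⁻¹ * ·) = (id : G → G) := by ext z; simp
  ext X
  exact (congrArg (fun f : G → G => l (mfderiv I I f 1 X)) hid).trans (by simp)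

variable [LieGroup I ∞ G]

theorem mdifferentiableAt_mul_left_infty (x y : G) : MDiffAt (x * ·) y :=
  (contMDiff_mul_left (I := I) (n := ∞) (a := x)).mdifferentiableAt (by simp)

theorem mulInvariantForm_mfderiv (l : GroupLieAlgebra I G →L[ℝ] ℝ) (x y : G)
    (X : TangentSpace I y) :
    mulInvariantForm l (x * y) (mfderiv I I (x * ·) y X) = mulInvariantForm l y X := by
  have hcomp : ((x * y)⁻¹ * ·) ∘ (x * ·) = (y⁻¹ * · : G → G) := by ext z; simp [mul_assoc]
  have hchain := mfderiv_comp_apply y (mdifferentiableAt_mul_left_infty (I := I) (x * y)⁻¹ (x * y))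
    (mdifferentiableAt_mul_left_infty x y) X
  exact (congrArg l hchain).symm.trans (congrArg (fun f : G → G => l (mfderiv I I f y X)) hcomp)

theorem eq_zero_of_mfderiv_mul_left_eq_zero {x y : G} {X : TangentSpace I y}
    (h : mfderiv I I (x * ·) y X = 0) : X = 0 := by
  have hcomp : (x⁻¹ * ·) ∘ (x * ·) = (id : G → G) := by ext z; simp
  have hchain := mfderiv_comp_apply y (mdifferentiableAt_mul_left_infty (I := I) x⁻¹ (x * y))
    (mdifferentiableAt_mul_left_infty x y) X
  have hid := (congrArg (fun f : G → G => (mfderiv I I f y X : V)) hcomp).symm.trans hchain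
  rw [h, map_zero] at hid
  simpa only [mfderiv_id] using! hid

theorem contMDiff_mulInvariantVectorField_infty (u : GroupLieAlgebra I G) : ContMDiff I I.tangent ∞
    (fun x : G => (⟨x, mulInvariantVectorField u x⟩ : TangentBundle I G)) := by
  intro x
  have hmul : ContMDiffAt (I.prod I) I ∞ (Function.uncurry fun x y : G => x * y) (x, 1) :=
    (contMDiff_mul I ∞).contMDiffAt
  have hu : ContMDiffAt I I.tangent ∞ (fun _ : G => (⟨1, u⟩ : TangentBundle I G)) x :=
    contMDiffAt_const
  have h := ContMDiffAt.clm_apply_of_inCoordinates (E₁ := TangentSpace I) (E₂ := TangentSpace I)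
    (b₂ := fun x : G => x * 1) (ϕ := fun x => mfderiv I I (x * ·) 1)
    (hmul.mfderiv (fun x y => x * y) (fun _ => 1) contMDiffAt_const le_rfl) hu
    (contMDiff_mul_right (n := ∞)).contMDiffAt
  exact h.congr_of_eventuallyEq (.of_forall fun y => Bundle.TotalSpace.ext (mul_one y).symm HEq.rfl)

theorem contMDiff_mulInvariantForm (l : GroupLieAlgebra I G →L[ℝ] ℝ) :
    ContMDiff I (I.prod 𝓘(ℝ, V →L[ℝ] ℝ)) ∞ (fun x => Bundle.TotalSpace.mk' (V →L[ℝ] ℝ)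
      (E := fun x : G => TangentSpace I x →L[ℝ] Bundle.Trivial G ℝ x) x
      (mulInvariantForm l x)) := by
  intro x₀
  rw [contMDiffAt_hom_bundle]
  refine ⟨contMDiffAt_id, ?_⟩
  have hmul : ContMDiffAt (I.prod I) I ∞ (Function.uncurry fun x y : G => x⁻¹ * y) (x₀, x₀) :=
    (contMDiff_fst.inv.mul contMDiff_snd).contMDiffAt
  have hL := hmul.mfderiv (m := ∞) (fun x y => x⁻¹ * y) id contMDiffAt_id le_rfl
  let e := trivializationAt V (TangentSpace I) (x₀⁻¹ * x₀)
  have he : ∀ y : G, y = x₀⁻¹ * x₀ → ∀ Y : TangentSpace I y,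
      (e.symmL ℝ (x₀⁻¹ * x₀) (e.continuousLinearMapAt ℝ y Y) : V) = Y := by
    rintro y rfl Y
    exact e.symmL_continuousLinearMapAt (FiberBundle.mem_baseSet_trivializationAt' _) Y
  let l₀ : V →L[ℝ] ℝ := l
  refine (contMDiffAt_const (c := l₀.comp (e.symmL ℝ (x₀⁻¹ * x₀)))).clm_comp hL
    |>.congr_of_eventuallyEq (.of_forall fun x => ?_)
  ext X
  simp only [inTangentCoordinates, ContinuousLinearMap.inCoordinates, mulInvariantForm, id_eq,
    Bundle.Trivial.fiberBundle_trivializationAt', ContinuousLinearMap.id_comp,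
    Bundle.Trivial.continuousLinearMapAt_trivialization, ContinuousLinearMap.comp_apply]
  exact congrArg l₀ (he (x⁻¹ * x) (by simp) _).symm

theorem exists_isLeftInvariant_orthonormal {ι : Type*} [Finite ι] [DecidableEq ι]
    (u : Module.Basis ι ℝ (GroupLieAlgebra I G)) :
    ∃ g : RiemMetric I G, IsLeftInvariant g ∧
      ∀ i j, g.inner 1 (u i) (u j) = if i = j then 1 else 0 := by
  have := Fintype.ofFinite ι
  have : FiniteDimensional ℝ V := u.finiteDimensional_of_finite
  let B : Module.Basis ι ℝ V := u
  let l (i : ι) : GroupLieAlgebra I G →L[ℝ] ℝ :=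
    (LinearMap.toContinuousLinearMap (B.coord i) : V →L[ℝ] ℝ)
  have hl (x : G) (X : TangentSpace I x) (hX : ∀ i, mulInvariantForm (l i) x X = 0) : X = 0 :=
    eq_zero_of_mfderiv_mul_left_eq_zero (B.forall_coord_eq_zero_iff.1 hX)
  refine ⟨.ofCoframe (fun i => mulInvariantForm (l i)) hl
    fun i => contMDiff_mulInvariantForm (l i), fun x y X Y => ?_, fun i j => ?_⟩
  · simp only [RiemMetric.ofCoframe_inner, mulInvariantForm_mfderiv]
  · have hdual (i j : ι) : l i (u j) = if j = i then 1 else 0 := u.repr_self_apply j i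
    simp [RiemMetric.ofCoframe_inner, mulInvariantForm_one, hdual]

theorem IsLeftInvariant.inner_mulInvariantVectorField {g : RiemMetric I G} (hg : IsLeftInvariant g)
    (u v : GroupLieAlgebra I G) (x : G) :
    g.inner x (mulInvariantVectorField u x) (mulInvariantVectorField v x) = g.inner 1 u v := by
  have hx : ∀ y, y = x → ∀ X Y : V, g.inner x X Y = g.inner y X Y := by rintro y rfl X Y; rfl
  exact (hx _ (mul_one x) _ _).trans (hg x 1 u v)

theorem IsLeftInvariant.isOrthonormalFrame [FiniteDimensional ℝ V] {ι : Type*} [Fintype ι]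
    [DecidableEq ι] {g : RiemMetric I G} (hg : IsLeftInvariant g) {u : ι → GroupLieAlgebra I G}
    (hcard : Fintype.card ι = Module.finrank ℝ V)
    (hu : ∀ i j, g.inner 1 (u i) (u j) = if i = j then 1 else 0) :
    IsOrthonormalFrame g (fun i => mulInvariantVectorField (u i)) :=
  .of_card_eq_finrank hcard (fun i => contMDiff_mulInvariantVectorField_infty (u i))
    fun x i j => (hg.inner_mulInvariantVectorField (u i) (u j) x).trans (hu i j)

theorem IsLeftInvariant.structureCoeff_eq [CompleteSpace V] {ι : Type*} {g : RiemMetric I G}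
    (hg : IsLeftInvariant g) (u : ι → GroupLieAlgebra I G) (x : G) (i j k : ι) :
    structureCoeff g (fun i => mulInvariantVectorField (u i)) x i j k =
      g.inner 1 ⁅u i, u j⁆ (u k) := by
  have : LieGroup I (minSmoothness ℝ 3) G := by
    rw [minSmoothness_of_isRCLikeNormedField]
    exact .of_le (n := ∞) (WithTop.coe_le_coe.2 le_top)
  rw [structureCoeff, ← mulInvariantVector_mlieBracket, hg.inner_mulInvariantVectorField,
    GroupLieAlgebra.bracket_def]

end LieGroup

theorem mlieBracket_eq_lieBracket {𝕜 E : Type*} [NontriviallyNormedField 𝕜]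
    [NormedAddCommGroup E] [NormedSpace 𝕜 E] (V W : ∀ x : E, TangentSpace 𝓘(𝕜, E) x) :
    VectorField.mlieBracket 𝓘(𝕜, E) V W = VectorField.lieBracket 𝕜 V W := by
  rw [← VectorField.mlieBracketWithin_univ, VectorField.mlieBracketWithin_eq_lieBracketWithin]
  exact VectorField.lieBracketWithin_univ

section HeisenbergAlgebra

variable {n : ℕ} {a b : Fin n → ℝ} {c : ℝ}

/-- The differential `(v, w, x) ↦ (v, w, x + z.v ⬝ w)` of the left translation of the Heisenberg
group by `z`, at any point. -/
def heisTranslate (z : HeisModel n) : HeisModel n →L[ℝ] HeisModel n :=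
  ContinuousLinearMap.id ℝ _ + (∑ p, z.1 p • (ContinuousLinearMap.proj p).comp
    ((ContinuousLinearMap.fst ℝ _ _).comp (ContinuousLinearMap.snd ℝ _ _))).smulRight (0, 0, 1)

theorem heisTranslate_apply (z X : HeisModel n) :
    heisTranslate z X = (X.1, X.2.1, X.2.2 + z.1 ⬝ᵥ X.2.1) := by
  simp [heisTranslate, Prod.ext_iff, dotProduct]

theorem mulInvariantVectorField_heis (u : HeisAlg n) (z : Heisenberg n) :
    mulInvariantVectorField u z = heisTranslate z u := by
  have hderiv (z y : HeisModel n) : HasFDerivAt (fun y : HeisModel n =>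
      ((z.1 + y.1, z.2.1 + y.2.1, z.2.2 + y.2.2 + z.1 ⬝ᵥ y.2.1) : HeisModel n))
      (heisTranslate z) y := by
    convert! (heisTranslate z).hasFDerivAt.const_add z using 2
    rw [heisTranslate_apply]
    simp [Prod.ext_iff, add_assoc]
  have hmul : HasMFDerivAt 𝓘(ℝ, HeisModel n) 𝓘(ℝ, HeisModel n) (z * ·) (1 : Heisenberg n)
      (heisTranslate z) := (hderiv z 0).hasMFDerivAt
  exact congrArg (fun f : HeisModel n →L[ℝ] HeisModel n => f u) hmul.mfderiv

theorem heis_lie (u v : HeisAlg n) :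
    ⁅u, v⁆ = ((0, 0, (u : HeisModel n).1 ⬝ᵥ (v : HeisModel n).2.1 -
      (v : HeisModel n).1 ⬝ᵥ (u : HeisModel n).2.1) : HeisModel n) := by
  have hderiv (w : HeisModel n) : HasFDerivAt (fun z : HeisModel n => heisTranslate z w)
      ((∑ p, w.2.1 p • (ContinuousLinearMap.proj p).comp
        (ContinuousLinearMap.fst ℝ _ _)).smulRight ((0, 0, 1) : HeisModel n)) 0 := by
    convert! (ContinuousLinearMap.hasFDerivAt _).const_add w using 2
    simp [heisTranslate_apply, Prod.ext_iff, dotProduct, mul_comm]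
  have hbracket (u v : HeisModel n) :
      VectorField.lieBracket ℝ (fun z : HeisModel n => heisTranslate z u)
        (fun z => heisTranslate z v) 0 = (0, 0, u.1 ⬝ᵥ v.2.1 - v.1 ⬝ᵥ u.2.1) := by
    rw [VectorField.lieBracket, (hderiv u).fderiv, (hderiv v).fderiv]
    simp [heisTranslate_apply, dotProduct, mul_comm]
  have hfield (w : HeisAlg n) : mulInvariantVectorField (G := Heisenberg n) w =
      fun z => heisTranslate z w := funext (mulInvariantVectorField_heis w)
  rw [GroupLieAlgebra.bracket_def, hfield, hfield]
  exact (congrFun (mlieBracket_eq_lieBracket _ _) (0 : HeisModel n)).trans (hbracket u v)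

theorem hasHeisRelations_heisBasis (ha : ∀ p, 0 < a p) (hc : 0 < c) :
    HasHeisRelations a b c (heisBasis a b c) := by
  have hzero : ((0, 0, 0) : HeisModel n) = (0 : HeisAlg n) := rfl
  have hscale p : √(c / (a p * b p)) * (√c)⁻¹ = (√(a p))⁻¹ * (√(b p))⁻¹ := by
    have := Real.sqrt_pos.2 hc
    rw [Real.sqrt_div hc.le, Real.sqrt_mul (ha p).le]
    field_simp
  have hZ p : √(c / (a p * b p)) • ((0, 0, (√c)⁻¹) : HeisModel n) =
      (0, 0, (√(a p))⁻¹ * (√(b p))⁻¹) := by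
    simp [hscale]
  refine ⟨fun p q => (heis_lie _ _).trans ?_, fun p => (heis_lie _ _).trans ?_,
    fun p => (heis_lie _ _).trans ?_, fun p q => (heis_lie _ _).trans ?_,
    fun p q => (heis_lie _ _).trans ?_⟩
  · split_ifs with hpq
    · subst hpq
      refine Eq.trans ?_ (hZ p).symm
      simp only [heisBasis, single_dotProduct, Pi.single_eq_same, zero_dotProduct, sub_zero]
      rfl
    · simp [heisBasis, hpq, hzero]
  all_goals simp [heisBasis, hzero]

theorem card_heisIndex (n : ℕ) :
    Fintype.card (HeisIndex n) = Module.finrank ℝ (HeisModel n) := by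
  simp only [Fintype.card_sum, Fintype.card_unit, Fintype.card_fin, Module.finrank_prod,
    Module.finrank_fintype_fun_eq_card, Module.finrank_self]
  omega

theorem linearIndependent_heisBasis (ha : ∀ p, 0 < a p) (hb : ∀ p, 0 < b p) (hc : 0 < c) :
    LinearIndependent ℝ (heisBasis a b c) := by
  have hinv {t : ℝ} (ht : 0 < t) : (√t)⁻¹ ≠ 0 := inv_ne_zero (Real.sqrt_pos.2 ht).ne'
  rw [Fintype.linearIndependent_iff]
  intro r hr
  let u : HeisIndex n → HeisModel n := heisBasis a b c
  have hu : ∑ i, r i • u i = 0 := hr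
  have hZ : r .Z * (√c)⁻¹ = 0 := by
    have := congrArg (fun X : HeisModel n => X.2.2) hu
    simpa [u, heisBasis, Prod.fst_sum, Prod.snd_sum] using this
  have hE p : r (.E p) * (√(a p))⁻¹ = 0 := by
    have := congrArg (fun X : HeisModel n => X.1 p) hu
    simpa [u, heisBasis, Prod.fst_sum, Prod.snd_sum, Pi.single_apply] using this
  have hF p : r (.F p) * (√(b p))⁻¹ = 0 := by
    have := congrArg (fun X : HeisModel n => X.2.1 p) hu
    simpa [u, heisBasis, Prod.fst_sum, Prod.snd_sum, Pi.single_apply] using this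
  rintro (i | p | p)
  exacts [(mul_eq_zero_iff_right (hinv hc)).1 hZ, (mul_eq_zero_iff_right (hinv (ha p))).1 (hE p),
    (mul_eq_zero_iff_right (hinv (hb p))).1 (hF p)]

theorem exists_isLeftInvariantWith_heisBasis (ha : ∀ p, 0 < a p) (hb : ∀ p, 0 < b p)
    (hc : 0 < c) :
    ∃ g : RiemMetric 𝓘(ℝ, HeisModel n) (Heisenberg n), IsLeftInvariantWith g (heisBasis a b c) := by
  let u : Module.Basis (HeisIndex n) ℝ (HeisAlg n) := basisOfLinearIndependentOfCardEqFinrank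
    (linearIndependent_heisBasis ha hb hc) (card_heisIndex n)
  have hu : ⇑u = heisBasis a b c := coe_basisOfLinearIndependentOfCardEqFinrank _ _
  obtain ⟨g, hg, horth⟩ := exists_isLeftInvariant_orthonormal u
  exact ⟨g, hg, hu ▸ horth⟩

theorem IsLeftInvariantWith.isOrthonormalFrame {g : RiemMetric 𝓘(ℝ, HeisModel n) (Heisenberg n)}
    {u : HeisIndex n → HeisAlg n} (hg : IsLeftInvariantWith g u) :
    IsOrthonormalFrame g (leftInvFrame u) :=
  hg.1.isOrthonormalFrame (card_heisIndex n) hg.2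

/-- The skew form `ω` with `[X, Y] = ω(X, Y) Z` in the basis `(Z, E_1, F_1, …, E_n, F_n)`, when
`[E_p, F_p] = 4 l_p Z`; the factor makes `l_p` an eigenvalue of the spinor `1`. -/
def heisForm (l : Fin n → ℝ) : HeisIndex n → HeisIndex n → ℝ
  | .inr (.inl p), .inr (.inr q) => if p = q then 4 * l p else 0
  | .inr (.inr p), .inr (.inl q) => if p = q then -(4 * l p) else 0
  | _, _ => 0

theorem HasHeisRelations.lie_eq {u : HeisIndex n → HeisAlg n} (h : HasHeisRelations a b c u)
    (i j : HeisIndex n) : ⁅u i, u j⁆ = heisForm (heisLambda a b c) i j • u .Z := by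
  have hskew (v w : HeisAlg n) : ⁅v, w⁆ = -⁅w, v⁆ := VectorField.mlieBracket_swap_apply
  have hself (v : HeisAlg n) : ⁅v, v⁆ = 0 := congrFun VectorField.mlieBracket_self _
  have hscale p : 4 * heisLambda a b c p = √(c / (a p * b p)) := by rw [heisLambda]; ring
  rcases i with i | p | p <;> rcases j with j | q | q <;> simp only [heisForm, zero_smul, hscale]
  · exact hself _
  · rw [hskew, h.lie_E_Z, neg_zero]
  · rw [hskew, h.lie_F_Z, neg_zero]
  · exact h.lie_E_Z p
  · exact h.lie_E_E p q
  · rw [h.lie_E_F, ite_smul, zero_smul]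
  · exact h.lie_F_Z p
  · rw [hskew, h.lie_E_F]
    split_ifs with hqp hpq hpq
    · rw [hpq, neg_smul]
    · exact absurd hqp.symm hpq
    · exact absurd hpq.symm hqp
    · rw [zero_smul, neg_zero]
  · exact h.lie_F_F p q

/-- The structure constants `g([e_i, e_j], e_k) = ω(e_i, e_j) δ_{kZ}`. -/
def heisStructure (l : Fin n → ℝ) (i j k : HeisIndex n) : ℝ :=
  if .Z = k then heisForm l i j else 0

theorem HasHeisRelations.structureCoeff_eq {u : HeisIndex n → HeisAlg n}
    (h : HasHeisRelations a b c u) {g : RiemMetric 𝓘(ℝ, HeisModel n) (Heisenberg n)}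
    (hg : IsLeftInvariantWith g u) (z : Heisenberg n) :
    structureCoeff g (leftInvFrame u) z = heisStructure (heisLambda a b c) := by
  funext i j k
  refine (hg.1.structureCoeff_eq u z i j k).trans ?_
  simp [h.lie_eq, hg.2, heisStructure]

end HeisenbergAlgebra

section HeisenbergSpinor

variable {n : ℕ} {a b : Fin n → ℝ} {c : ℝ}

theorem contractX_one (p : Fin n) : contractX p (1 : Spinor n) = 0 :=
  CliffordAlgebra.contractLeft_one (Q := (0 : QuadraticForm ℂ (Fin n → ℂ))) _

theorem parity_one : parity (1 : Spinor n) = 1 :=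
  map_one (CliffordAlgebra.involute (Q := (0 : QuadraticForm ℂ (Fin n → ℂ))))

theorem wedgeY_self (p : Fin n) (η : Spinor n) : wedgeY p (wedgeY p η) = 0 := by
  have hsq (z : ExteriorAlgebra ℂ (Fin n → ℂ)) :
      ExteriorAlgebra.ι ℂ (Pi.single p 1) * (ExteriorAlgebra.ι ℂ (Pi.single p 1) * z) = 0 := by
    rw [← mul_assoc, ExteriorAlgebra.ι_sq_zero, zero_mul]
  exact hsq η

theorem spinor_one_ne_zero : (1 : Spinor n) ≠ 0 :=
  one_ne_zero (α := ExteriorAlgebra ℂ (Fin n → ℂ))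

theorem heisGamma_Z_one (i : Unit) :
    heisGamma (.inl i) (1 : Spinor n) = Complex.I • (1 : Spinor n) := by
  simp [heisGamma, parity_one]

theorem heisGamma_E_one (p : Fin n) :
    heisGamma (.E p) (1 : Spinor n) = Complex.I • wedgeY p 1 := by
  simp [heisGamma, contractX_one]

theorem heisGamma_F_one (p : Fin n) : heisGamma (.F p) (1 : Spinor n) = wedgeY p 1 := by
  simp [heisGamma, contractX_one]

/-- The eigenvalues of the spinor `1`, indexed by the frame: `λ_p` on `E_p` and `F_p`, and
`μ = -∑ λ_q` on `Z`. -/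
def heisEigenvalue (l : Fin n → ℝ) : HeisIndex n → ℝ
  | .inl _ => -∑ q, l q
  | .inr (.inl p) => l p
  | .inr (.inr p) => l p

theorem range_heisEigenvalue (l : Fin n → ℝ) :
    Set.range (heisEigenvalue l) = Set.range l ∪ {-∑ q, l q} := by
  ext r
  simp [heisEigenvalue, eq_comm]

theorem heisGamma_anticomm {i j : HeisIndex n} (hij : i ≠ j) (η : Spinor n) :
    heisGamma j (heisGamma i η) = -heisGamma i (heisGamma j η) := by
  rw [eq_neg_iff_add_eq_zero, heisGamma_clifford, if_neg hij.symm]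

theorem heisForm_eq_sum (l : Fin n → ℝ) (j k : HeisIndex n) :
    heisForm l j k = ∑ p, 4 * l p * skewSingle (.E p) (.F p) j k := by
  rcases j with j | j | j <;> rcases k with k | k | k <;>
    simp [heisForm, skewSingle, eq_comm, neg_ite]

theorem koszul_heisStructure_Z (l : Fin n → ℝ) (i : Unit) :
    koszul (heisStructure l) (.inl i) =
      fun j k => ∑ p, -2 * l p * skewSingle (.E p) (.F p) j k := by
  funext j k
  have hZ (k : HeisIndex n) : heisForm l (.inl i) k = 0 ∧ heisForm l k (.inl i) = 0 := by
    rcases k with k | k | k <;> exact ⟨rfl, rfl⟩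
  have hform : koszul (heisStructure l) (.inl i) j k = -(1 / 2) * heisForm l j k := by
    simp only [koszul, heisStructure, (hZ _).1, (hZ _).2, if_true, ite_self]
    ring
  rw [hform, heisForm_eq_sum, Finset.mul_sum]
  exact Finset.sum_congr rfl fun p _ => by ring

theorem koszul_heisStructure_E (l : Fin n → ℝ) (p : Fin n) :
    koszul (heisStructure l) (.E p) = fun j k => 2 * l p * skewSingle (.F p) .Z j k := by
  funext j k
  rcases j with j | j | j <;> rcases k with k | k | k <;>
    grind [koszul, heisStructure, heisForm, skewSingle]

theorem koszul_heisStructure_F (l : Fin n → ℝ) (p : Fin n) :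
    koszul (heisStructure l) (.F p) = fun j k => -2 * l p * skewSingle (.E p) .Z j k := by
  funext j k
  rcases j with j | j | j <;> rcases k with k | k | k <;>
    grind [koszul, heisStructure, heisForm, skewSingle]

theorem spinLift_heisStructure_one (l : Fin n → ℝ) (i : HeisIndex n) :
    spinLift heisGamma (koszul (heisStructure l) i) (1 : Spinor n) =
      (heisEigenvalue l i : ℂ) • heisGamma i (1 : Spinor n) := by
  have hskew {i j : HeisIndex n} (hij : i ≠ j) :
      spinLift heisGamma (skewSingle i j) (1 : Spinor n) =
        (1 / 2 : ℂ) • heisGamma i (heisGamma j 1) :=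
    spinLift_skewSingle (heisGamma_anticomm hij 1)
  have hI (η : Spinor n) : Complex.I • Complex.I • η = -η := by
    rw [smul_smul, Complex.I_mul_I, neg_one_smul]
  have hEF p : heisGamma (.E p) (heisGamma (.F p) (1 : Spinor n)) = Complex.I • 1 := by
    simp [heisGamma, contractX_one, contractX_wedgeY, wedgeY_self]
  have hFZ p : heisGamma (.F p) (heisGamma .Z (1 : Spinor n)) = heisGamma (.E p) 1 := by
    rw [heisGamma_Z_one, map_smul, heisGamma_F_one, heisGamma_E_one]
  have hEZ p : heisGamma (.E p) (heisGamma .Z (1 : Spinor n)) = -heisGamma (.F p) 1 := by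
    rw [heisGamma_Z_one, map_smul, heisGamma_F_one, heisGamma_E_one, hI]
  rcases i with i | p | p
  · rw [koszul_heisStructure_Z, spinLift_sum_mul, heisGamma_Z_one, heisEigenvalue]
    simp only [hskew, hEF, ne_eq, reduceCtorEq, not_false_eq_true, Sum.inr.injEq]
    push_cast
    rw [← Finset.sum_neg_distrib, Finset.sum_smul]
    exact Finset.sum_congr rfl fun p _ => by module
  · rw [koszul_heisStructure_E, spinLift_mul, hskew (by simp), hFZ, heisEigenvalue]
    push_cast
    module
  · rw [koszul_heisStructure_F, spinLift_mul, hskew (by simp), hEZ, heisEigenvalue]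
    push_cast
    module

theorem heisGamma_one_independent (r : HeisIndex n → ℝ)
    (h : ∑ i, (r i : ℂ) • heisGamma i (1 : Spinor n) = 0) : r = 0 := by
  have hsum : ((r .Z : ℂ) * Complex.I) • (1 : Spinor n) +
      ∑ p, ((r (.E p) : ℂ) * Complex.I + r (.F p)) • wedgeY p 1 = 0 := by
    simpa only [Fintype.sum_sum_type, Finset.univ_unique, Finset.sum_singleton, heisGamma_Z_one,
      heisGamma_E_one, heisGamma_F_one, smul_smul, add_smul, Finset.sum_add_distrib] using h
  have hEF (q : Fin n) : (r (.E q) : ℂ) * Complex.I + r (.F q) = 0 := by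
    have hq := congrArg (contractX q) hsum
    simp only [map_add, map_smul, map_sum, map_zero, contractX_wedgeY, contractX_one, smul_zero,
      sub_zero, zero_add, ite_smul, zero_smul, one_smul, smul_ite, Finset.sum_ite_eq,
      Finset.mem_univ, if_true] at hq
    exact (smul_eq_zero.1 hq).resolve_right spinor_one_ne_zero
  have hZ : (r .Z : ℂ) * Complex.I = 0 := by
    simp only [hEF, zero_smul, Finset.sum_const_zero, add_zero] at hsum
    exact (smul_eq_zero.1 hsum).resolve_right spinor_one_ne_zero
  funext i
  rcases i with i | p | p
  · simpa using hZ
  · simpa using congrArg Complex.im (hEF p)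
  · simpa using congrArg Complex.re (hEF p)

variable {u : HeisIndex n → HeisAlg n} {g : RiemMetric 𝓘(ℝ, HeisModel n) (Heisenberg n)}
  {nabla : HeisConnection n}

namespace HasHeisRelations

theorem spinLift_koszul_one (hu : HasHeisRelations a b c u) (hg : IsLeftInvariantWith g u)
    (x : Heisenberg n) (i : HeisIndex n) :
    spinLift heisGamma (koszul (structureCoeff g (leftInvFrame u) x) i) (1 : Spinor n) =
      (heisEigenvalue (heisLambda a b c) i : ℂ) • heisGamma i (1 : Spinor n) := by
  rw [hu.structureCoeff_eq hg, spinLift_heisStructure_one]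

theorem isGenKillingWith_one (hu : HasHeisRelations a b c u) (hg : IsLeftInvariantWith g u)
    (hn : IsLeviCivita g nabla) :
    IsGenKillingWith g nabla (leftInvFrame u) heisGamma (invariantSpinor 1)
      (diagEndo g (leftInvFrame u) (heisEigenvalue (heisLambda a b c))) :=
  hg.isOrthonormalFrame.isGenKillingWith_diagEndo hn (hu.spinLift_koszul_one hg)

theorem eigenvaluesAt_eq (hu : HasHeisRelations a b c u) (hg : IsLeftInvariantWith g u)
    (hn : IsLeviCivita g nabla) {A : HeisEndo n}
    (hA : IsGenKillingWith g nabla (leftInvFrame u) heisGamma (invariantSpinor 1) A)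
    (x : Heisenberg n) :
    eigenvaluesAt A x = Set.range (heisLambda a b c) ∪ {-∑ q, heisLambda a b c q} := by
  rw [← range_heisEigenvalue]
  exact hg.isOrthonormalFrame.eigenvaluesAt_eq_range hn (hu.spinLift_koszul_one hg)
    heisGamma_one_independent hA x

end HasHeisRelations

theorem ncard_range_union_neg_sum {l : Fin n → ℝ} (hpos : ∀ p, 0 < l p)
    (hinj : Function.Injective l) : (Set.range l ∪ {-∑ q, l q}).ncard = n + 1 := by
  have hnotMem : -∑ q, l q ∉ Set.range l := by
    rintro ⟨p, hp⟩
    have hsum := Finset.sum_nonneg fun q (_ : q ∈ Finset.univ) => (hpos q).le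
    linarith [hpos p]
  rw [Set.union_singleton, Set.ncard_insert_of_notMem hnotMem, ← Set.image_univ,
    Set.ncard_image_of_injective _ hinj, Set.ncard_univ, Nat.card_fin]

theorem heisLambda_sq (ha : ∀ p, a p = ((p : ℝ) + 1) ^ 2) (hb : ∀ p, b p = 1) (p : Fin n) :
    heisLambda a b 1 p = 1 / 4 * ((p : ℝ) + 1)⁻¹ := by
  rw [heisLambda, ha, hb, mul_one, one_div (_ ^ 2), Real.sqrt_inv, Real.sqrt_sq (by positivity)]

theorem ncard_eigenvalues_sq (ha : ∀ p, a p = ((p : ℝ) + 1) ^ 2) (hb : ∀ p, b p = 1) :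
    (Set.range (heisLambda a b 1) ∪ {-∑ q, heisLambda a b 1 q}).ncard = n + 1 := by
  refine ncard_range_union_neg_sum (fun p => ?_) fun p q h => ?_
  · rw [heisLambda_sq ha hb]
    positivity
  · rw [heisLambda_sq ha hb, heisLambda_sq ha hb] at h
    have hval := inv_injective (mul_left_cancel₀ (by norm_num) h)
    exact Fin.ext (by exact_mod_cast add_right_cancel hval)

end HeisenbergSpinor

end

theorem theorem3p3 :
    -- `Ẑ/√c`, `Ê_p/√a_p`, `F̂_p/√b_p` is orthonormal for some left-invariant metric
    (∀ (n : ℕ) (a b : Fin n → ℝ) (c : ℝ), (∀ p, 0 < a p) → (∀ p, 0 < b p) → 0 < c →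
      HasHeisRelations a b c (heisBasis a b c) ∧
      ∃ g : RiemMetric 𝓘(ℝ, HeisModel n) (Heisenberg n),
        IsLeftInvariantWith g (heisBasis a b c)) ∧
    -- the spinor `1` is generalised Killing, with eigenvalues `λ_p` and `μ = -∑ λ_q`
    (∀ (n : ℕ) (a b : Fin n → ℝ) (c : ℝ), (∀ p, 0 < a p) → (∀ p, 0 < b p) → 0 < c →
      ∀ (u : HeisIndex n → HeisAlg n) (g : RiemMetric 𝓘(ℝ, HeisModel n) (Heisenberg n)),
        HasHeisRelations a b c u → IsLeftInvariantWith g u →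
        (∃ nabla : HeisConnection n, IsLeviCivita g nabla) ∧
        ∀ nabla : HeisConnection n, IsLeviCivita g nabla →
          IsGenKilling g nabla (leftInvFrame u) heisGamma (invariantSpinor 1) ∧
          ∀ A : HeisEndo n,
            IsGenKillingWith g nabla (leftInvFrame u) heisGamma (invariantSpinor 1) A →
            ∀ x, eigenvaluesAt A x =
              Set.range (heisLambda a b c) ∪ {-∑ q, heisLambda a b c q}) ∧
    -- for `b_p = c = 1`, `a_p = p²` (`p = 1, …, n`) there are `n + 1` distinct eigenvalues
    (∀ (n : ℕ) (a b : Fin n → ℝ), (∀ p, a p = ((p : ℝ) + 1) ^ 2) → (∀ p, b p = 1) →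
      ∀ (g : RiemMetric 𝓘(ℝ, HeisModel n) (Heisenberg n)) (nabla : HeisConnection n),
        IsLeftInvariantWith g (heisBasis a b 1) → IsLeviCivita g nabla →
        ∀ A : HeisEndo n,
          IsGenKillingWith g nabla (leftInvFrame (heisBasis a b 1)) heisGamma
            (invariantSpinor 1) A →
          ∀ x, (eigenvaluesAt A x).ncard = n + 1) ∧
    -- generalised Killing spinors exist with any number of distinct eigenvalues
    (∀ r : ℕ, 1 ≤ r → ∃ (n : ℕ) (u : HeisIndex n → HeisAlg n)
      (g : RiemMetric 𝓘(ℝ, HeisModel n) (Heisenberg n)) (nabla : HeisConnection n)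
      (s : Spinor n) (A : HeisEndo n),
        IsLeftInvariantWith g u ∧ IsLeviCivita g nabla ∧ s ≠ 0 ∧
        IsGenKillingWith g nabla (leftInvFrame u) heisGamma (invariantSpinor s) A ∧
        ∀ x, (eigenvaluesAt A x).ncard = r) := by
  refine ⟨fun n a b c ha hb hc => ⟨hasHeisRelations_heisBasis ha hc,
      exists_isLeftInvariantWith_heisBasis ha hb hc⟩,
    fun n a b c _ _ _ u g hu hg => ?_, fun n a b ha hb g nabla hg hn A hA x => ?_,
    fun r hr => ?_⟩
  · exact ⟨⟨_, hg.isOrthonormalFrame.isLeviCivita_leviCivita⟩,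
      fun nabla hn => ⟨⟨_, hu.isGenKillingWith_one hg hn⟩,
        fun A hA x => hu.eigenvaluesAt_eq hg hn hA x⟩⟩
  · have hu := hasHeisRelations_heisBasis (a := a) (b := b) (c := 1)
      (fun p => by rw [ha]; positivity) one_pos
    rw [hu.eigenvaluesAt_eq hg hn hA x]
    exact ncard_eigenvalues_sq ha hb
  · obtain ⟨n, rfl⟩ : ∃ n, r = n + 1 := ⟨r - 1, by omega⟩
    let a : Fin n → ℝ := fun p => ((p : ℝ) + 1) ^ 2
    have ha p : 0 < a p := by positivity
    have hu := hasHeisRelations_heisBasis (b := 1) ha one_pos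
    obtain ⟨g, hg⟩ := exists_isLeftInvariantWith_heisBasis ha (fun _ => one_pos) one_pos
    have hn := hg.isOrthonormalFrame.isLeviCivita_leviCivita
    have hA := hu.isGenKillingWith_one hg hn
    refine ⟨n, _, g, _, 1, _, hg, hn, spinor_one_ne_zero, hA, fun x => ?_⟩
    rw [hu.eigenvaluesAt_eq hg hn hA x]
    exact ncard_eigenvalues_sq (fun _ => rfl) (fun _ => rfl)
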